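/- For real numbers $x,\theta$ and an integer $K\ge 0$ let $$S_K(x,\theta)=\sum_{j=1}^{K}\exp(\pi i x j^2+2\pi i\theta j)\qquad(S_0=0).$$ Let $0<x<1$, $-\tfrac12\le\theta\le\tfrac12$, let $N\ge1$ be an integer and put $f(t)=\exp(\pi i x t^2+2\pi i\theta t)$. Let $\xi=Nx+\theta$, let $M$ be the nearest integer to $\xi$ and $\epsilon=\xi-M$, with the convention $-\tfrac12<\epsilon\le\tfrac12$. Set $$E(t)=e^{-\pi i t^2/x}\,\mathrm{erfc}\bigl(e^{-\pi i/4}\,t\sqrt{\pi/x}\bigr),\qquad \mathrm{erfc}(z)=1-\frac{2}{\sqrt\pi}\int_0^z e^{-w^2}\,dw .$$ With the Hurwitz zeta function $\zeta(s,a)=\sum_{k\ge0}(k+a)^{-s}$ ($s>1$, $a>0$) define, for $|\lambda|<1$, $$\Delta_r^{\pm}(\lambda)=\zeta(2r+1,1+\lambda)\pm\zeta(2r+1,1-\lambda)\quad(r\ge1),\qquad \Delta_0^-(\lambda)=\pi\cot\pi\lambda-\frac1\lambda\quad(\lambda\ne0),\qquad \Delta_0^-(0)=0,$$ and let $C_r=f(N)\,\Delta_r^-(\epsilon)-\Delta_r^-(\theta)$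 for $r\ge0$. Then, if $M\ge0$, for every integer $n\ge1$ one has $$S_N(x,\theta)-\frac{e^{-\pi i\theta^2/x+\pi i/4}}{\sqrt x}\,S_M\!\left(-\frac1x,\frac{\theta}{x}\right)-\frac12\bigl(f(N)-1\bigr)-\frac{e^{\pi i/4}}{2\sqrt x}\bigl\{E(\theta)-f(N)E(\epsilon)\bigr\}$$ $$=\frac1{2\pi i}\sum_{r=0}^{n-1}\frac{\Gamma(r+\frac12)}{\Gamma(\frac12)}\left(\frac{x}{\pi i}\right)^{r}C_r+R_n,$$ where the remainder satisfies $$|R_n|\le\frac{(\frac12)_n}{2\pi}\left(\frac x\pi\right)^{n}\bigl(\Delta_n^+(\epsilon)+\Delta_n^+(\theta)\bigr),\qquad (a)_n=\frac{\Gamma(a+n)}{\Gamma(a)} .$$ -/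

import Mathlib

namespace QuadGauss

noncomputable section

/-- The summand `f(t) = exp(π i x t² + 2 π i θ t)`. -/
def f (x θ t : ℝ) : ℂ :=
  Complex.exp (Real.pi * Complex.I * x * t ^ 2 + 2 * Real.pi * Complex.I * θ * t)

/-- The generalised quadratic Gauss sum `S_N(x, θ) = ∑_{j=1}^N f(j)` (empty for `N = 0`). -/
def S (N : ℕ) (x θ : ℝ) : ℂ := ∑ j ∈ Finset.Icc 1 N, f x θ j

/-- The error function on `ℂ`: `erf z = (2/√π) ∫_0^z exp(-w²) dw`, integrated along the
segment from `0` to `z`, parametrised as `w = z s` with `0 ≤ s ≤ 1`. -/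
def erf (z : ℂ) : ℂ :=
  2 / (Real.sqrt Real.pi : ℂ) * ∫ s in (0 : ℝ)..1, z * Complex.exp (-(z * s) ^ 2)

/-- The complementary error function on `ℂ`. -/
def erfc (z : ℂ) : ℂ := 1 - erf z

/-- `E(t) = exp(-π i t² / x) erfc(ω t √(π/x))` with `ω = exp(-π i / 4)`. -/
def E (x t : ℝ) : ℂ :=
  Complex.exp (-(Real.pi * Complex.I * t ^ 2 / x)) *
    erfc (Complex.exp (-(Real.pi * Complex.I / 4)) * t * (Real.sqrt (Real.pi / x) : ℂ))

/-- The Hurwitz zeta function `ζ(s, a) = ∑_{k ≥ 0} (k + a)^{-s}` for real `s > 1` and `a > 0`.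
(Mathlib's `HurwitzZeta.hurwitzZeta` is made periodic in `a`, which is a different function.) -/
def zeta (s a : ℝ) : ℝ := ∑' k : ℕ, ((k : ℝ) + a) ^ (-s)

/-- `Δ_r^+(l)`, used for `r ≥ 1` and `|l| < 1`. -/
def DeltaPlus (r : ℕ) (l : ℝ) : ℝ :=
  zeta (2 * r + 1) (1 + l) + zeta (2 * r + 1) (1 - l)

/-- `Δ_r^-(l)` for `|l| < 1`; for `r = 0` the removable singularity at `l = 0` is filled in by
its limit `0`. -/
def DeltaMinus (r : ℕ) (l : ℝ) : ℝ :=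
  if r = 0 then
    if l = 0 then 0 else Real.pi * Real.cot (Real.pi * l) - l⁻¹
  else zeta (2 * r + 1) (1 + l) - zeta (2 * r + 1) (1 - l)

/-- The Pochhammer symbol `(a)_r = Γ(a + r) / Γ(a)`. -/
def poch (a : ℝ) (r : ℕ) : ℝ := Real.Gamma (a + r) / Real.Gamma a

/-- The coefficient `C_r = f(N) Δ_r^-(ε) - Δ_r^-(θ)`. -/
def C (x θ : ℝ) (N : ℕ) (ε : ℝ) (r : ℕ) : ℂ :=
  f x θ N * (DeltaMinus r ε : ℂ) - (DeltaMinus r θ : ℂ)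

end

end QuadGauss

/-! Poisson summation on `[0, N]` turns the trapezoidal sum of `f` into the symmetric series, over
all integers `m`, of the integrals of `f x (θ + m)`. Each integral is a difference of half-line
Fresnel integrals, `G x (θ + m) - f x θ N * G x (N * x + θ + m)` (`integral_f_eq_G`), so everything
reduces to symmetric sums of `G` over `θ + ℤ` and `N x + θ + ℤ`.

For `a > 0`, `G x a` has an expansion in odd powers of `1 / a` with error at most the first omitted
term (`norm_G_add_sum_le`). It comes from the Stieltjes representation `erfc_omega_mul`, by
expanding the kernel `1 / (s² - iτ²)` geometrically and using `|s² - iτ²| ≥ τ²`. For `a < 0`,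
reflection (`G_neg`) produces a full-line integral, `stationaryTerm`. These have constant modulus
and do not sum, but those of the two families agree once the second is multiplied by `f x θ N`
(`f_mul_stationaryTerm`), and so cancel.

Replacing `N x + θ` by `ε = N x + θ - M` leaves exactly `M` stationary terms
(`tendsto_symSum_add_nat`), which form the dual sum `S_M(-1/x, θ/x)`. The central terms `G x θ` and
`G x ε` are the two `E` terms. In the remaining series of `G x (k + 1 + l) - G x (k + 1 - l)`, `l =
θ, ε`, the expansion summed over `k` gives the `Δ_r^-` and an error controlled by `Δ_n^+`
(`exists_hasSum_G`). -/

namespace QuadGauss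

noncomputable section

open MeasureTheory Filter Topology

/-! ### The error function along a ray -/

/-- The primitive eighth root of unity `exp(-π i / 4)`. -/
def omega : ℂ := Complex.exp (-(Real.pi * Complex.I / 4))

lemma omega_ne_zero : omega ≠ 0 := Complex.exp_ne_zero _

lemma omega_sq : omega ^ 2 = -Complex.I := by
  rw [omega, ← Complex.exp_nat_mul,
    show ((2 : ℕ) : ℂ) * -(Real.pi * Complex.I / 4) = -(Real.pi / 2 * Complex.I) by push_cast; ring,
    Complex.exp_neg, Complex.exp_pi_div_two_mul_I, Complex.inv_I]

lemma exp_pi_div_four_mul_omega : Complex.exp (Real.pi * Complex.I / 4) * omega = 1 := by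
  rw [omega, ← Complex.exp_add]; simp

lemma erf_ofReal_mul (c : ℂ) (t : ℝ) :
    erf (c * t) = 2 / (Real.sqrt Real.pi : ℂ) * ∫ s in (0 : ℝ)..t, c * Complex.exp (-(c * s) ^ 2) := by
  have h := intervalIntegral.smul_integral_comp_mul_left (a := 0) (b := 1)
    (fun s : ℝ => c * Complex.exp (-(c * s) ^ 2)) t
  rw [mul_zero, mul_one] at h
  rw [erf, ← h, ← intervalIntegral.integral_smul]
  congr 2
  ext s
  simp only [Complex.real_smul, Complex.ofReal_mul]
  rw [show c * t * s = c * (t * s) by ring]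
  ring

lemma hasDerivAt_erf_ofReal_mul (c : ℂ) (t : ℝ) :
    HasDerivAt (fun t : ℝ => erf (c * t))
      (2 / (Real.sqrt Real.pi : ℂ) * (c * Complex.exp (-(c * t) ^ 2))) t := by
  simp_rw [erf_ofReal_mul]
  refine HasDerivAt.const_mul _ ?_
  have hc : Continuous fun s : ℝ => c * Complex.exp (-(c * s) ^ 2) := by fun_prop
  exact intervalIntegral.integral_hasDerivAt_right (hc.intervalIntegrable _ _)
    (hc.stronglyMeasurableAtFilter _ _) hc.continuousAt

lemma erf_neg (z : ℂ) : erf (-z) = -erf z := by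
  simp only [erf, neg_mul, neg_sq, intervalIntegral.integral_neg, mul_neg]

lemma erfc_neg (z : ℂ) : erfc (-z) = 2 - erfc z := by
  rw [erfc, erfc, erf_neg]; ring

lemma hasDerivAt_erfc_ofReal_mul (c : ℂ) (t : ℝ) :
    HasDerivAt (fun t : ℝ => erfc (c * t))
      (-(2 / (Real.sqrt Real.pi : ℂ) * (c * Complex.exp (-(c * t) ^ 2)))) t :=
  (hasDerivAt_erf_ofReal_mul c t).const_sub 1

/-! ### The Stieltjes integral `W` and its differential equation -/

lemma sq_le_norm_sq_sub (s τ : ℝ) : τ ^ 2 ≤ ‖((s : ℂ) ^ 2 - Complex.I * τ ^ 2)‖ := by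
  have h := Complex.abs_im_le_norm ((s : ℂ) ^ 2 - Complex.I * τ ^ 2)
  have : ((s : ℂ) ^ 2 - Complex.I * τ ^ 2).im = - τ ^ 2 := by
    simp [← Complex.ofReal_pow]
  rw [this, abs_neg, abs_of_nonneg (sq_nonneg τ)] at h
  exact h

lemma sq_sub_ne_zero (s : ℝ) {τ : ℝ} (hτ : 0 < τ) : ((s : ℂ) ^ 2 - Complex.I * τ ^ 2) ≠ 0 :=
  norm_pos_iff.mp (lt_of_lt_of_le (by positivity) (sq_le_norm_sq_sub s τ))

/-- The Stieltjes-type integral `∫ e^{-s²} / (s² - i τ²) ds` over the real line. -/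
def W (τ : ℝ) : ℂ := ∫ s : ℝ, (Real.exp (-s ^ 2) : ℂ) / ((s : ℂ) ^ 2 - Complex.I * τ ^ 2)

lemma integrable_exp_neg_sq : Integrable fun s : ℝ => Real.exp (-s ^ 2) := by
  simpa using integrable_exp_neg_mul_sq (b := 1) one_pos

lemma integrable_pow_mul_exp_neg_sq (n : ℕ) :
    Integrable fun s : ℝ => s ^ n * Real.exp (-s ^ 2) := by
  have := integrable_rpow_mul_exp_neg_mul_sq (b := 1) one_pos (s := (n : ℝ))
    (by have : (0 : ℝ) ≤ n := n.cast_nonneg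
        linarith)
  simpa using this

lemma continuous_W_integrand {τ : ℝ} (hτ : 0 < τ) (k : ℕ) :
    Continuous fun s : ℝ => (Real.exp (-s ^ 2) : ℂ) / ((s : ℂ) ^ 2 - Complex.I * τ ^ 2) ^ k := by
  refine Continuous.div (by fun_prop) (by fun_prop) fun s => pow_ne_zero _ (sq_sub_ne_zero s hτ)

lemma norm_W_integrand_le {τ : ℝ} (hτ : 0 < τ) (k : ℕ) (s : ℝ) :
    ‖(Real.exp (-s ^ 2) : ℂ) / ((s : ℂ) ^ 2 - Complex.I * τ ^ 2) ^ k‖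
      ≤ Real.exp (-s ^ 2) * ((τ ^ 2) ^ k)⁻¹ := by
  rw [norm_div, norm_pow, Complex.norm_real, Real.norm_of_nonneg (Real.exp_pos _).le, div_eq_mul_inv]
  gcongr
  exact sq_le_norm_sq_sub s τ

lemma integrable_W_integrand {τ : ℝ} (hτ : 0 < τ) (k : ℕ) :
    Integrable fun s : ℝ => (Real.exp (-s ^ 2) : ℂ) / ((s : ℂ) ^ 2 - Complex.I * τ ^ 2) ^ k :=
  (integrable_exp_neg_sq.mul_const _).mono' (continuous_W_integrand hτ k).aestronglyMeasurable
    (Eventually.of_forall (norm_W_integrand_le hτ k))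

lemma hasDerivAt_W {τ : ℝ} (hτ : 0 < τ) :
    HasDerivAt W (2 * Complex.I * τ *
      ∫ s : ℝ, (Real.exp (-s ^ 2) : ℂ) / ((s : ℂ) ^ 2 - Complex.I * τ ^ 2) ^ 2) τ := by
  rw [← integral_const_mul]
  have hmem : Set.Ioo (τ / 2) (2 * τ) ∈ 𝓝 τ := Ioo_mem_nhds (by linarith) (by linarith)
  have hcont : Continuous fun s : ℝ => (Real.exp (-s ^ 2) : ℂ) := by fun_prop
  refine (hasDerivAt_integral_of_dominated_loc_of_deriv_le
    (F := fun (τ : ℝ) (s : ℝ) => (Real.exp (-s ^ 2) : ℂ) / ((s : ℂ) ^ 2 - Complex.I * τ ^ 2))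
    (F' := fun (τ : ℝ) (s : ℝ) => 2 * Complex.I * τ *
      ((Real.exp (-s ^ 2) : ℂ) / ((s : ℂ) ^ 2 - Complex.I * τ ^ 2) ^ 2))
    -- For `t` in `(τ/2, 2τ)` the factor `2t` is below `4τ` and the squared kernel is at most
    -- `(τ/2)⁻⁴`.
    (bound := fun s => (4 * τ * (((τ / 2) ^ 2) ^ 2)⁻¹) * Real.exp (-s ^ 2))
    hmem ?_ ?_ ?_ ?_ ?_ ?_).2
  · filter_upwards [hmem] with t ht
    simpa using (continuous_W_integrand (τ := t) (by linarith [ht.1]) 1).aestronglyMeasurable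
  · simpa using integrable_W_integrand hτ 1
  · exact ((continuous_W_integrand hτ 2).const_mul _).aestronglyMeasurable
  · refine Eventually.of_forall fun s t ht => ?_
    have ht0 : 0 < t := by linarith [ht.1]
    have h := norm_W_integrand_le ht0 2 s
    rw [norm_mul, norm_mul, norm_mul, Complex.norm_I, Complex.norm_real, Real.norm_of_nonneg ht0.le]
    calc _ ≤ ‖(2 : ℂ)‖ * 1 * t * (Real.exp (-s ^ 2) * ((t ^ 2) ^ 2)⁻¹) := by gcongr
      _ ≤ ‖(2 : ℂ)‖ * 1 * (2 * τ) * (Real.exp (-s ^ 2) * (((τ / 2) ^ 2) ^ 2)⁻¹) := by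
        gcongr
        · exact ht.2.le
        · exact ht.1.le
      _ = _ := by rw [Complex.norm_ofNat]; ring
  · exact integrable_exp_neg_sq.const_mul _
  · refine Eventually.of_forall fun s t ht => ?_
    have ht0 : 0 < t := by linarith [ht.1]
    have hd : HasDerivAt (fun t : ℝ => (s : ℂ) ^ 2 - Complex.I * (t : ℂ) ^ 2)
        (-(Complex.I * (2 * t))) t := by
      have := ((((hasDerivAt_id (t : ℂ)).comp_ofReal).pow 2).const_mul Complex.I).const_sub
        ((s : ℂ) ^ 2)
      simpa using this
    have := (hasDerivAt_const t (Real.exp (-s ^ 2) : ℂ)).div hd (sq_sub_ne_zero s ht0)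
    refine this.congr_deriv ?_
    ring

lemma integral_exp_neg_sq_complex : ∫ s : ℝ, (Real.exp (-s ^ 2) : ℂ) = (Real.sqrt Real.pi : ℂ) := by
  rw [integral_complex_ofReal]
  have := integral_gaussian 1
  simp only [neg_mul, one_mul, div_one] at this
  rw [this]

/-- Writing `s² = (s² - iτ²) + iτ²`, the derivative of `s e^{-s²} / (s² - iτ²)` becomes minus the
combination integrated here, and its integral over the line is zero. Since the second integral is
`W'(τ) / (2iτ)`, this is a first-order linear differential equation for `W`. -/
lemma W_recurrence {τ : ℝ} (hτ : 0 < τ) :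
    (1 + 2 * Complex.I * τ ^ 2) * W τ + 2 * Complex.I * τ ^ 2 *
      ∫ s : ℝ, (Real.exp (-s ^ 2) : ℂ) / ((s : ℂ) ^ 2 - Complex.I * τ ^ 2) ^ 2
      = -2 * (Real.sqrt Real.pi : ℂ) := by
  have i1 := integrable_W_integrand hτ 1
  simp only [pow_one] at i1
  have i2 := integrable_W_integrand hτ 2
  have i0 : Integrable fun s : ℝ => (Real.exp (-s ^ 2) : ℂ) := integrable_exp_neg_sq.ofReal
  have i12 : Integrable fun s : ℝ =>
      (1 + 2 * Complex.I * τ ^ 2) * ((Real.exp (-s ^ 2) : ℂ) / ((s : ℂ) ^ 2 - Complex.I * τ ^ 2))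
        + 2 * Complex.I * τ ^ 2 *
          ((Real.exp (-s ^ 2) : ℂ) / ((s : ℂ) ^ 2 - Complex.I * τ ^ 2) ^ 2) :=
    (i1.const_mul _).add (i2.const_mul _)
  have hint : Integrable fun s : ℝ =>
      -((1 + 2 * Complex.I * τ ^ 2) * ((Real.exp (-s ^ 2) : ℂ) / ((s : ℂ) ^ 2 - Complex.I * τ ^ 2))
        + 2 * Complex.I * τ ^ 2 *
          ((Real.exp (-s ^ 2) : ℂ) / ((s : ℂ) ^ 2 - Complex.I * τ ^ 2) ^ 2)
        + 2 * (Real.exp (-s ^ 2) : ℂ)) :=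
    (i12.add (i0.const_mul _)).neg
  have hint' : Integrable fun s : ℝ =>
      (s : ℂ) * ((Real.exp (-s ^ 2) : ℂ) / ((s : ℂ) ^ 2 - Complex.I * τ ^ 2)) := by
    refine (((integrable_pow_mul_exp_neg_sq 1).norm).mul_const ((τ ^ 2) ^ 1)⁻¹).mono' ?_ ?_
    · have := continuous_W_integrand hτ 1
      simp only [pow_one] at this
      exact (Complex.continuous_ofReal.mul this).aestronglyMeasurable
    · refine Eventually.of_forall fun s => ?_
      have := norm_W_integrand_le hτ 1 s
      rw [norm_mul, Complex.norm_real]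
      simp only [pow_one, norm_mul, Real.norm_of_nonneg (Real.exp_pos (-s ^ 2)).le] at this ⊢
      rw [mul_assoc]
      gcongr
  have h0 := integral_eq_zero_of_hasDerivAt_of_integrable (fun s : ℝ => ?_) hint hint'
  · rw [integral_neg, integral_add i12 (i0.const_mul _),
      integral_add (i1.const_mul _) (i2.const_mul _), integral_const_mul, integral_const_mul,
      integral_const_mul, integral_exp_neg_sq_complex, neg_eq_zero] at h0
    rw [W]
    linear_combination h0
  · have hs : HasDerivAt (fun s : ℝ => (s : ℂ)) 1 s := (hasDerivAt_id (s : ℂ)).comp_ofReal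
    have hq : HasDerivAt (fun s : ℝ => (s : ℂ) ^ 2 - Complex.I * (τ : ℂ) ^ 2) (2 * s) s := by
      simpa using (hs.pow 2).sub_const (Complex.I * (τ : ℂ) ^ 2)
    have he : HasDerivAt (fun s : ℝ => (Real.exp (-s ^ 2) : ℂ)) (Real.exp (-s ^ 2) * (-(2 * s))) s := by
      have := ((((hasDerivAt_id s).pow 2).neg).exp).ofReal_comp
      simpa using this
    have hne := sq_sub_ne_zero s hτ
    refine (hs.mul (he.div hq hne)).congr_deriv ?_
    simp only [Pi.div_apply]
    field_simp
    ring

/-- `τ e^{iτ²} W τ` is the product that integrates the equation in `W_recurrence`. The derivative is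
that of `erfc (ω τ)`, because `-(ωτ)² = iτ²`. -/
lemma hasDerivAt_exp_I_mul_sq_mul_W {τ : ℝ} (hτ : 0 < τ) :
    HasDerivAt (fun τ : ℝ => Complex.exp (Complex.I * τ ^ 2) * (omega * τ / Real.pi * W τ))
      (-(2 / (Real.sqrt Real.pi : ℂ) * (omega * Complex.exp (-(omega * τ) ^ 2)))) τ := by
  have hs : HasDerivAt (fun s : ℝ => (s : ℂ)) 1 τ := (hasDerivAt_id (τ : ℂ)).comp_ofReal
  have h1 := ((hs.pow 2).const_mul Complex.I).cexp
  have h2 := ((hs.const_mul omega).div_const (Real.pi : ℂ)).mul (hasDerivAt_W hτ)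
  refine (h1.mul h2).congr_deriv ?_
  have hr := W_recurrence hτ
  set B := ∫ s : ℝ, (Real.exp (-s ^ 2) : ℂ) / ((s : ℂ) ^ 2 - Complex.I * τ ^ 2) ^ 2
  have hpi : (Real.sqrt Real.pi : ℂ) * (Real.sqrt Real.pi : ℂ) = Real.pi := by
    rw [← Complex.ofReal_mul, Real.mul_self_sqrt Real.pi_pos.le]
  have hpi0 : (Real.sqrt Real.pi : ℂ) ≠ 0 :=
    Complex.ofReal_ne_zero.mpr (Real.sqrt_pos.mpr Real.pi_pos).ne'
  rw [show -(omega * (τ : ℂ)) ^ 2 = Complex.I * τ ^ 2 by rw [mul_pow, omega_sq]; ring]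
  simp only [Pi.pow_apply, Pi.mul_apply, ← hpi]
  field_simp
  simp only [Nat.cast_ofNat, Nat.reduceSub, pow_one]
  linear_combination omega * hr

/-! ### The limit of `τ W τ` at zero -/

lemma sq_sub_I_ne_zero (v : ℝ) : (v : ℂ) ^ 2 - Complex.I ≠ 0 := by
  simpa using sq_sub_ne_zero v one_pos

lemma continuous_inv_sq_sub_I : Continuous fun v : ℝ => ((v : ℂ) ^ 2 - Complex.I)⁻¹ :=
  Continuous.inv₀ (by fun_prop) sq_sub_I_ne_zero

lemma norm_inv_sq_sub_I_le (v : ℝ) : ‖((v : ℂ) ^ 2 - Complex.I)⁻¹‖ ≤ 2 * (1 + v ^ 2)⁻¹ := by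
  rw [norm_inv, ← inv_inv (2 : ℝ), ← mul_inv]
  refine inv_anti₀ (by positivity) ?_
  have h1 := sq_le_norm_sq_sub v 1
  have h2 := Complex.re_le_norm ((v : ℂ) ^ 2 - Complex.I)
  have h3 : ((v : ℂ) ^ 2 - Complex.I).re = v ^ 2 := by simp [← Complex.ofReal_pow]
  simp only [Complex.ofReal_one, one_pow, mul_one] at h1
  linarith

lemma integrable_inv_sq_sub_I : Integrable fun v : ℝ => ((v : ℂ) ^ 2 - Complex.I)⁻¹ :=
  (integrable_inv_one_add_sq.const_mul 2).mono' continuous_inv_sq_sub_I.aestronglyMeasurable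
    (Eventually.of_forall norm_inv_sq_sub_I_le)

lemma omega_eq : omega = (Real.sqrt 2 / 2 : ℝ) * (1 - Complex.I) := by
  rw [omega, show -(Real.pi * Complex.I / 4) = ((-(Real.pi / 4) : ℝ) : ℂ) * Complex.I by
    push_cast; ring, Complex.exp_mul_I, ← Complex.ofReal_cos, ← Complex.ofReal_sin, Real.cos_neg,
    Real.sin_neg, Real.cos_pi_div_four, Real.sin_pi_div_four]
  push_cast
  ring

lemma sq_add_sqrt_two_mul_pos (v : ℝ) : 0 < v ^ 2 + Real.sqrt 2 * v + 1 := by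
  have h2 : Real.sqrt 2 ^ 2 = 2 := Real.sq_sqrt (by norm_num)
  nlinarith [sq_nonneg (2 * v + Real.sqrt 2)]

lemma sq_sub_sqrt_two_mul_pos (v : ℝ) : 0 < v ^ 2 - Real.sqrt 2 * v + 1 := by
  simpa [sub_eq_add_neg] using sq_add_sqrt_two_mul_pos (-v)

/-- Half of an antiderivative of `1 / (v² - i) = (v² + i) / (1 + v⁴)`, split as `(1+i)/2 ·
(v²+1)/(1+v⁴) + (1-i)/2 · (v²-1)/(1+v⁴)`. Both halves rest on `1 + v⁴ = (v² + √2 v + 1)(v² - √2 v +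
1)`. -/
lemma hasDerivAt_arctan_add_arctan (v : ℝ) :
    HasDerivAt (fun v : ℝ => Real.sqrt 2 / 2 *
      (Real.arctan (Real.sqrt 2 * v + 1) + Real.arctan (Real.sqrt 2 * v - 1)))
      ((1 + v ^ 2) / (1 + v ^ 4)) v := by
  have h2 : Real.sqrt 2 ^ 2 = 2 := Real.sq_sqrt (by norm_num)
  have hd : HasDerivAt (fun v : ℝ => Real.sqrt 2 * v) (Real.sqrt 2) v := by
    simpa using (hasDerivAt_id v).const_mul (Real.sqrt 2)
  refine (((hd.add_const 1).arctan.add (hd.sub_const 1).arctan).const_mul _).congr_deriv ?_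
  have hp := (sq_add_sqrt_two_mul_pos v).ne'
  have hm := (sq_sub_sqrt_two_mul_pos v).ne'
  have e1 : 1 + (Real.sqrt 2 * v + 1) ^ 2 = 2 * (v ^ 2 + Real.sqrt 2 * v + 1) := by
    linear_combination v ^ 2 * h2
  have e2 : 1 + (Real.sqrt 2 * v - 1) ^ 2 = 2 * (v ^ 2 - Real.sqrt 2 * v + 1) := by
    linear_combination v ^ 2 * h2
  have e3 : 1 + v ^ 4 = (v ^ 2 + Real.sqrt 2 * v + 1) * (v ^ 2 - Real.sqrt 2 * v + 1) := by
    linear_combination v ^ 2 * h2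
  rw [e1, e2, e3]
  obtain ⟨P, hP⟩ : ∃ P, v ^ 2 + Real.sqrt 2 * v + 1 = P := ⟨_, rfl⟩
  obtain ⟨Q, hQ⟩ : ∃ Q, v ^ 2 - Real.sqrt 2 * v + 1 = Q := ⟨_, rfl⟩
  rw [hP] at hp ⊢
  rw [hQ] at hm ⊢
  field_simp
  linear_combination (2 * (1 + v ^ 2)) * h2 - Real.sqrt 2 ^ 2 * hP - Real.sqrt 2 ^ 2 * hQ

lemma hasDerivAt_log_sub_log (v : ℝ) :
    HasDerivAt (fun v : ℝ => Real.sqrt 2 / 4 *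
      (Real.log (v ^ 2 - Real.sqrt 2 * v + 1) - Real.log (v ^ 2 + Real.sqrt 2 * v + 1)))
      ((v ^ 2 - 1) / (1 + v ^ 4)) v := by
  have h2 : Real.sqrt 2 ^ 2 = 2 := Real.sq_sqrt (by norm_num)
  have hd : HasDerivAt (fun v : ℝ => Real.sqrt 2 * v) (Real.sqrt 2) v := by
    simpa using (hasDerivAt_id v).const_mul (Real.sqrt 2)
  have hq : HasDerivAt (fun v : ℝ => v ^ 2) (2 * v) v := by
    simpa using hasDerivAt_pow 2 v
  have hp := (sq_add_sqrt_two_mul_pos v).ne'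
  have hm := (sq_sub_sqrt_two_mul_pos v).ne'
  refine (((((hq.sub hd).add_const 1).log hm).sub
    (((hq.add hd).add_const 1).log hp)).const_mul _).congr_deriv ?_
  have e3 : 1 + v ^ 4 = (v ^ 2 + Real.sqrt 2 * v + 1) * (v ^ 2 - Real.sqrt 2 * v + 1) := by
    linear_combination v ^ 2 * h2
  rw [e3]
  simp only [Pi.sub_apply, Pi.add_apply]
  obtain ⟨P, hP⟩ : ∃ P, v ^ 2 + Real.sqrt 2 * v + 1 = P := ⟨_, rfl⟩
  obtain ⟨Q, hQ⟩ : ∃ Q, v ^ 2 - Real.sqrt 2 * v + 1 = Q := ⟨_, rfl⟩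
  rw [hP] at hp ⊢
  rw [hQ] at hm ⊢
  field_simp
  linear_combination (2 * (v ^ 2 - 1)) * h2 + Real.sqrt 2 * (2 * v + Real.sqrt 2) * hQ
    - Real.sqrt 2 * (2 * v - Real.sqrt 2) * hP

/-- The function is invariant under `v ↦ 1/v`, so its limit at infinity is its value at `0`. -/
lemma tendsto_log_sub_log {l : Filter ℝ} (hl : Tendsto (fun v : ℝ => v⁻¹) l (𝓝 0))
    (h0 : ∀ᶠ v in l, v ≠ 0) :
    Tendsto (fun v : ℝ => Real.sqrt 2 / 4 *
      (Real.log (v ^ 2 - Real.sqrt 2 * v + 1) - Real.log (v ^ 2 + Real.sqrt 2 * v + 1))) l (𝓝 0) := by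
  have hc : ContinuousAt (fun u : ℝ => Real.sqrt 2 / 4 *
      (Real.log (u ^ 2 - Real.sqrt 2 * u + 1) - Real.log (u ^ 2 + Real.sqrt 2 * u + 1))) 0 :=
    ((hasDerivAt_log_sub_log 0)).continuousAt
  have := hc.tendsto.comp hl
  simp only [ne_eq, OfNat.ofNat_ne_zero, not_false_eq_true, zero_pow, mul_zero, sub_self, zero_add,
    add_zero, Real.log_one] at this
  refine this.congr' ?_
  filter_upwards [h0] with v hv
  have hp := sq_add_sqrt_two_mul_pos v⁻¹
  have hm := sq_sub_sqrt_two_mul_pos v⁻¹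
  have e1 : v ^ 2 - Real.sqrt 2 * v + 1 = v ^ 2 * (v⁻¹ ^ 2 - Real.sqrt 2 * v⁻¹ + 1) := by
    field_simp; ring
  have e2 : v ^ 2 + Real.sqrt 2 * v + 1 = v ^ 2 * (v⁻¹ ^ 2 + Real.sqrt 2 * v⁻¹ + 1) := by
    field_simp; ring
  rw [e1, e2, Real.log_mul (by positivity) hm.ne', Real.log_mul (by positivity) hp.ne']
  simp only [Function.comp_apply]
  ring

lemma integral_inv_sq_sub_I : ∫ v : ℝ, ((v : ℂ) ^ 2 - Complex.I)⁻¹ = Real.pi / omega := by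
  have h2 : Real.sqrt 2 ^ 2 = 2 := Real.sq_sqrt (by norm_num)
  have hs2 : (0 : ℝ) < Real.sqrt 2 := by positivity
  have hderiv : ∀ v : ℝ, HasDerivAt (fun v : ℝ =>
      (1 + Complex.I) / 2 * ((Real.sqrt 2 / 2 *
        (Real.arctan (Real.sqrt 2 * v + 1) + Real.arctan (Real.sqrt 2 * v - 1)) : ℝ) : ℂ) +
      (1 - Complex.I) / 2 * ((Real.sqrt 2 / 4 *
        (Real.log (v ^ 2 - Real.sqrt 2 * v + 1) - Real.log (v ^ 2 + Real.sqrt 2 * v + 1)) : ℝ) : ℂ))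
      ((v : ℂ) ^ 2 - Complex.I)⁻¹ v := by
    intro v
    refine (((hasDerivAt_arctan_add_arctan v).ofReal_comp.const_mul _).add
      ((hasDerivAt_log_sub_log v).ofReal_comp.const_mul _)).congr_deriv ?_
    have h4 : (1 + (v : ℂ) ^ 4) ≠ 0 := by
      have : (0 : ℝ) < 1 + v ^ 4 := by positivity
      exact_mod_cast this.ne'
    have hI := sq_sub_I_ne_zero v
    push_cast
    field_simp
    linear_combination -2 * Complex.I_sq
  have htop : Tendsto (fun v : ℝ => Real.sqrt 2 / 2 *
      (Real.arctan (Real.sqrt 2 * v + 1) + Real.arctan (Real.sqrt 2 * v - 1))) atTop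
      (𝓝 (Real.sqrt 2 / 2 * (Real.pi / 2 + Real.pi / 2))) := by
    have hA := Real.tendsto_arctan_atTop.mono_right nhdsWithin_le_nhds
    have hm : Tendsto (fun v : ℝ => Real.sqrt 2 * v) atTop atTop := tendsto_id.const_mul_atTop hs2
    exact ((hA.comp (tendsto_atTop_add_const_right _ 1 hm)).add
      (hA.comp (tendsto_atTop_add_const_right _ (-1) hm))).const_mul _
  have hbot : Tendsto (fun v : ℝ => Real.sqrt 2 / 2 *
      (Real.arctan (Real.sqrt 2 * v + 1) + Real.arctan (Real.sqrt 2 * v - 1))) atBot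
      (𝓝 (Real.sqrt 2 / 2 * (-(Real.pi / 2) + -(Real.pi / 2)))) := by
    have hA := Real.tendsto_arctan_atBot.mono_right nhdsWithin_le_nhds
    have hm : Tendsto (fun v : ℝ => Real.sqrt 2 * v) atBot atBot := tendsto_id.const_mul_atBot hs2
    exact ((hA.comp (tendsto_atBot_add_const_right _ 1 hm)).add
      (hA.comp (tendsto_atBot_add_const_right _ (-1) hm))).const_mul _
  have ltop := tendsto_log_sub_log tendsto_inv_atTop_zero (eventually_ne_atTop 0)
  have lbot := tendsto_log_sub_log tendsto_inv_atBot_zero (eventually_ne_atBot 0)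
  have key := integral_of_hasDerivAt_of_tendsto hderiv integrable_inv_sq_sub_I
    (((Complex.continuous_ofReal.tendsto _).comp hbot).const_mul ((1 + Complex.I) / 2) |>.add
      (((Complex.continuous_ofReal.tendsto _).comp lbot).const_mul ((1 - Complex.I) / 2)))
    (((Complex.continuous_ofReal.tendsto _).comp htop).const_mul ((1 + Complex.I) / 2) |>.add
      (((Complex.continuous_ofReal.tendsto _).comp ltop).const_mul ((1 - Complex.I) / 2)))
  rw [key, eq_div_iff omega_ne_zero, omega_eq]
  have h2' : (Real.sqrt 2 : ℂ) ^ 2 = 2 := by exact_mod_cast h2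
  push_cast
  linear_combination (Real.pi / 4 * (1 - Complex.I ^ 2)) * h2' - Real.pi / 2 * Complex.I_sq

/-- The substitution `s = τ v` moves `τ` out of the kernel, which degenerates as `τ → 0`, into a
Gaussian bounded by `1`. -/
lemma ofReal_mul_W {τ : ℝ} (hτ : 0 < τ) :
    (τ : ℂ) * W τ = ∫ v : ℝ, (Real.exp (-(τ * v) ^ 2) : ℂ) * ((v : ℂ) ^ 2 - Complex.I)⁻¹ := by
  have h := Measure.integral_comp_mul_left
    (fun s : ℝ => (Real.exp (-s ^ 2) : ℂ) / ((s : ℂ) ^ 2 - Complex.I * τ ^ 2)) τ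
  have hτ' : (τ : ℂ) ≠ 0 := Complex.ofReal_ne_zero.mpr hτ.ne'
  rw [← W, abs_of_pos (inv_pos.mpr hτ), Complex.real_smul, Complex.ofReal_inv] at h
  calc (τ : ℂ) * W τ = (τ : ℂ) ^ 2 * ((τ : ℂ)⁻¹ * W τ) := by field_simp
    _ = _ := by
      rw [← h, ← integral_const_mul]
      congr 1
      ext v
      have hI := sq_sub_I_ne_zero v
      rw [Complex.ofReal_mul τ v, show ((τ : ℂ) * v) ^ 2 - Complex.I * τ ^ 2
        = (τ : ℂ) ^ 2 * ((v : ℂ) ^ 2 - Complex.I) by ring]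
      field_simp

lemma tendsto_ofReal_mul_W : Tendsto (fun τ : ℝ => (τ : ℂ) * W τ) (𝓝[>] 0) (𝓝 (Real.pi / omega)) := by
  rw [← integral_inv_sq_sub_I]
  have : Tendsto (fun τ : ℝ => ∫ v : ℝ,
      (Real.exp (-(τ * v) ^ 2) : ℂ) * ((v : ℂ) ^ 2 - Complex.I)⁻¹) (𝓝[>] 0)
      (𝓝 (∫ v : ℝ, ((v : ℂ) ^ 2 - Complex.I)⁻¹)) := by
    refine tendsto_integral_filter_of_dominated_convergence
      (fun v : ℝ => 2 * (1 + v ^ 2)⁻¹) ?_ ?_ (integrable_inv_one_add_sq.const_mul 2) ?_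
    · refine Eventually.of_forall fun τ => Continuous.aestronglyMeasurable ?_
      exact Continuous.mul (by fun_prop) continuous_inv_sq_sub_I
    · refine Eventually.of_forall fun τ => Eventually.of_forall fun v => ?_
      rw [norm_mul, Complex.norm_real, Real.norm_of_nonneg (Real.exp_pos _).le]
      calc _ ≤ 1 * ‖((v : ℂ) ^ 2 - Complex.I)⁻¹‖ := by
            gcongr
            exact Real.exp_le_one_iff.mpr (by nlinarith [sq_nonneg (τ * v)])
        _ ≤ _ := by rw [one_mul]; exact norm_inv_sq_sub_I_le v
    · refine Eventually.of_forall fun v => ?_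
      have hc : Continuous fun τ : ℝ =>
          (Real.exp (-(τ * v) ^ 2) : ℂ) * ((v : ℂ) ^ 2 - Complex.I)⁻¹ :=
        Continuous.mul (by fun_prop) continuous_const
      have := hc.tendsto 0
      simp only [zero_mul, ne_eq, OfNat.ofNat_ne_zero, not_false_eq_true, zero_pow, neg_zero,
        Real.exp_zero, Complex.ofReal_one, one_mul] at this
      exact this.mono_left nhdsWithin_le_nhds
  refine this.congr' ?_
  filter_upwards [self_mem_nhdsWithin] with τ hτ
  exact (ofReal_mul_W hτ).symm

/-- The Stieltjes representation of `erfc` on the ray `arg z = -π/4`. -/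
lemma erfc_omega_mul {τ : ℝ} (hτ : 0 < τ) :
    erfc (omega * τ) = Complex.exp (Complex.I * τ ^ 2) * (omega * τ / Real.pi * W τ) := by
  set g : ℝ → ℂ := fun τ => erfc (omega * τ) -
    Complex.exp (Complex.I * τ ^ 2) * (omega * τ / Real.pi * W τ) with hg
  have hd : ∀ t ∈ Set.Ioi (0 : ℝ), HasDerivAt g 0 t := fun t ht =>
    ((hasDerivAt_erfc_ofReal_mul omega t).sub (hasDerivAt_exp_I_mul_sq_mul_W ht)).congr_deriv
      (sub_self _)
  have hconst : ∀ t ∈ Set.Ioi (0 : ℝ), g t = g τ := fun t ht =>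
    isOpen_Ioi.is_const_of_deriv_eq_zero isPreconnected_Ioi
      (fun s hs => (hd s hs).differentiableAt.differentiableWithinAt) (fun s hs => (hd s hs).deriv)
      ht hτ
  -- The constant difference is found at `0+`: `erfc` tends to `1`, and so does the other side
  -- because `τ W τ → π / ω`.
  have hlim : Tendsto g (𝓝[>] 0) (𝓝 0) := by
    have h1 : Tendsto (fun t : ℝ => erfc (omega * t)) (𝓝[>] 0) (𝓝 1) := by
      have := (hasDerivAt_erfc_ofReal_mul omega 0).continuousAt.tendsto
      simp only [Complex.ofReal_zero, mul_zero] at this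
      rw [show erfc 0 = 1 by simp [erfc, erf]] at this
      exact this.mono_left nhdsWithin_le_nhds
    have h2 : Tendsto (fun t : ℝ => Complex.exp (Complex.I * t ^ 2)) (𝓝[>] 0) (𝓝 1) := by
      have hc : Continuous fun t : ℝ => Complex.exp (Complex.I * t ^ 2) := by fun_prop
      have := hc.tendsto 0
      simp only [Complex.ofReal_zero, ne_eq, OfNat.ofNat_ne_zero, not_false_eq_true, zero_pow,
        mul_zero, Complex.exp_zero] at this
      exact this.mono_left nhdsWithin_le_nhds
    have h3 := h1.sub (h2.mul (tendsto_ofReal_mul_W.const_mul (omega / Real.pi)))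
    have hpi : (Real.pi : ℂ) ≠ 0 := Complex.ofReal_ne_zero.mpr Real.pi_ne_zero
    rw [show (1 : ℂ) - 1 * (omega / Real.pi * (Real.pi / omega)) = 0 by
      have := omega_ne_zero
      field_simp
      ring] at h3
    refine h3.congr fun t => ?_
    simp only [hg]
    ring
  have hz : g τ = 0 := by
    refine tendsto_nhds_unique ?_ hlim
    refine tendsto_const_nhds.congr' ?_
    filter_upwards [self_mem_nhdsWithin] with t ht
    exact (hconst t ht).symm
  exact sub_eq_zero.mp hz

/-! ### Asymptotic expansion with explicit remainder -/

lemma integral_pow_mul_exp_neg_sq (r : ℕ) :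
    ∫ s : ℝ, s ^ (2 * r) * Real.exp (-s ^ 2) = Real.Gamma (r + 1 / 2) := by
  have h := integral_comp_abs (f := fun s : ℝ => s ^ (2 * r) * Real.exp (-s ^ 2))
  simp only [pow_mul, sq_abs] at h ⊢
  rw [h]
  have h2 := integral_rpow_mul_exp_neg_rpow (p := 2) (q := ((2 * r : ℕ) : ℝ)) two_pos
    (by have : (0 : ℝ) ≤ ((2 * r : ℕ) : ℝ) := Nat.cast_nonneg _
        linarith)
  simp only [Real.rpow_natCast, Real.rpow_two, pow_mul] at h2
  rw [h2, ← mul_assoc]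
  push_cast
  rw [show (2 : ℝ) * (1 / 2) = 1 by norm_num, one_mul]
  congr 1
  ring

lemma inv_add_eq_sum {K : Type*} [Field K] (u w : K) (hw : w ≠ 0) (huw : u + w ≠ 0) (n : ℕ) :
    (u + w)⁻¹ = ∑ r ∈ Finset.range n, (-1) ^ r / w ^ (r + 1) * u ^ r
      + (-1) ^ n / w ^ n * (u ^ n * (u + w)⁻¹) := by
  induction n with
  | zero => simp
  | succ n ih =>
    refine ih.trans ?_
    rw [Finset.sum_range_succ, add_assoc]
    congr 1
    field_simp
    ring

/-- The kernel is expanded as a finite geometric sum in `s²`, with exact remainder. That remainder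
keeps the factor `1 / (s² - iτ²)`, of modulus at most `τ⁻²`, so the error is bounded by the modulus
of the first omitted term. -/
lemma norm_W_sub_sum_le {τ : ℝ} (hτ : 0 < τ) (n : ℕ) :
    ‖W τ - ∑ r ∈ Finset.range n,
      (-1) ^ r / (-(Complex.I * τ ^ 2)) ^ (r + 1) * (Real.Gamma (r + 1 / 2) : ℂ)‖
      ≤ Real.Gamma (n + 1 / 2) * (τ⁻¹) ^ (2 * n + 2) := by
  have hτ' : (τ : ℂ) ≠ 0 := Complex.ofReal_ne_zero.mpr hτ.ne'
  have hw : -(Complex.I * (τ : ℂ) ^ 2) ≠ 0 := by simp [hτ.ne']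
  have hmono : ∀ r : ℕ, Integrable fun s : ℝ => ((s ^ (2 * r) * Real.exp (-s ^ 2) : ℝ) : ℂ) :=
    fun r => (integrable_pow_mul_exp_neg_sq (2 * r)).ofReal
  have hsum : Integrable fun s : ℝ => ∑ r ∈ Finset.range n,
      (-1) ^ r / (-(Complex.I * (τ : ℂ) ^ 2)) ^ (r + 1) *
        ((s ^ (2 * r) * Real.exp (-s ^ 2) : ℝ) : ℂ) :=
    integrable_finsetSum _ fun r _ => (hmono r).const_mul _
  have hI : ∑ r ∈ Finset.range n,
      (-1) ^ r / (-(Complex.I * τ ^ 2)) ^ (r + 1) * (Real.Gamma (r + 1 / 2) : ℂ)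
      = ∫ s : ℝ, ∑ r ∈ Finset.range n, (-1) ^ r / (-(Complex.I * (τ : ℂ) ^ 2)) ^ (r + 1) *
        ((s ^ (2 * r) * Real.exp (-s ^ 2) : ℝ) : ℂ) := by
    rw [integral_finsetSum _ fun r _ => (hmono r).const_mul _]
    refine Finset.sum_congr rfl fun r _ => ?_
    rw [integral_const_mul, integral_complex_ofReal, integral_pow_mul_exp_neg_sq]
  have i1 := integrable_W_integrand hτ 1
  simp only [pow_one] at i1
  rw [hI, W, ← integral_sub i1 hsum, ← integral_pow_mul_exp_neg_sq, ← integral_mul_const]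
  refine norm_integral_le_of_norm_le ((integrable_pow_mul_exp_neg_sq (2 * n)).mul_const _)
    (Eventually.of_forall fun s => ?_)
  have hne := sq_sub_ne_zero s hτ
  have e := inv_add_eq_sum ((s : ℂ) ^ 2) (-(Complex.I * (τ : ℂ) ^ 2)) hw
    (by rwa [← sub_eq_add_neg]) n
  have e2 : (Real.exp (-s ^ 2) : ℂ) / ((s : ℂ) ^ 2 - Complex.I * τ ^ 2) -
      ∑ r ∈ Finset.range n, (-1) ^ r / (-(Complex.I * (τ : ℂ) ^ 2)) ^ (r + 1) *
        ((s ^ (2 * r) * Real.exp (-s ^ 2) : ℝ) : ℂ)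
      = (-1) ^ n / (-(Complex.I * (τ : ℂ) ^ 2)) ^ n *
        (((s ^ (2 * n) * Real.exp (-s ^ 2) : ℝ) : ℂ) * ((s : ℂ) ^ 2 - Complex.I * τ ^ 2)⁻¹) := by
    have e3 : ∑ r ∈ Finset.range n, (-1) ^ r / (-(Complex.I * (τ : ℂ) ^ 2)) ^ (r + 1) *
        ((s ^ (2 * r) * Real.exp (-s ^ 2) : ℝ) : ℂ) = (Real.exp (-s ^ 2) : ℂ) *
        ∑ r ∈ Finset.range n, (-1) ^ r / (-(Complex.I * (τ : ℂ) ^ 2)) ^ (r + 1) *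
          ((s : ℂ) ^ 2) ^ r := by
      rw [Finset.mul_sum]
      refine Finset.sum_congr rfl fun r _ => ?_
      push_cast
      ring
    rw [e3, div_eq_mul_inv, sub_eq_add_neg ((s : ℂ) ^ 2), ← mul_sub, sub_eq_of_eq_add' e]
    push_cast
    ring
  rw [e2, norm_mul, norm_mul, norm_div, norm_pow, norm_pow, norm_neg, norm_neg, norm_one, one_pow,
    norm_mul, Complex.norm_I, norm_pow, Complex.norm_real, Complex.norm_real, norm_inv,
    Real.norm_of_nonneg hτ.le,
    Real.norm_of_nonneg (mul_nonneg (by rw [pow_mul]; positivity) (Real.exp_pos _).le)]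
  have hpos : 0 ≤ s ^ (2 * n) * Real.exp (-s ^ 2) :=
    mul_nonneg (by rw [pow_mul]; positivity) (Real.exp_pos _).le
  calc _ ≤ 1 / (1 * τ ^ 2) ^ n * (s ^ (2 * n) * Real.exp (-s ^ 2) * (τ ^ 2)⁻¹) := by
        gcongr
        exact sq_le_norm_sq_sub s τ
    _ = _ := by
      rw [one_mul, pow_add, pow_mul, inv_pow, inv_pow, one_div]
      ring

/-- The oscillatory integral `∫_0^∞ exp(π i x t² + 2 π i a t) dt`, in closed form. -/
def G (x a : ℝ) : ℂ := Complex.exp (Real.pi * Complex.I / 4) / (2 * (Real.sqrt x : ℂ)) * E x a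

lemma G_eq_W {x a : ℝ} (hx : 0 < x) (ha : 0 < a) :
    G x a = ((a * Real.sqrt (Real.pi / x) : ℝ) : ℂ) / (2 * Real.pi * (Real.sqrt x : ℂ))
      * W (a * Real.sqrt (Real.pi / x)) := by
  set τ := a * Real.sqrt (Real.pi / x) with hτ
  have hτ0 : 0 < τ := mul_pos ha (Real.sqrt_pos.mpr (div_pos Real.pi_pos hx))
  have hsq : (τ : ℂ) ^ 2 = Real.pi * a ^ 2 / x := by
    have : τ ^ 2 = Real.pi * a ^ 2 / x := by
      rw [hτ, mul_pow, Real.sq_sqrt (div_pos Real.pi_pos hx).le]; ring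
    exact_mod_cast this
  have harg : Complex.exp (-(Real.pi * Complex.I / 4)) * a * (Real.sqrt (Real.pi / x) : ℂ)
      = omega * τ := by
    rw [hτ, omega]; push_cast; ring
  have hE : E x a = omega * τ / Real.pi * W τ := by
    rw [E, harg, erfc_omega_mul hτ0, ← mul_assoc, ← Complex.exp_add, hsq,
      show -(Real.pi * Complex.I * (a : ℂ) ^ 2 / x) + Complex.I * (Real.pi * a ^ 2 / x) = 0 by ring,
      Complex.exp_zero, one_mul]
  have hx' : (Real.sqrt x : ℂ) ≠ 0 := Complex.ofReal_ne_zero.mpr (Real.sqrt_pos.mpr hx).ne'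
  have hpi : (Real.pi : ℂ) ≠ 0 := Complex.ofReal_ne_zero.mpr Real.pi_ne_zero
  rw [G, hE]
  field_simp
  linear_combination (τ : ℂ) * W τ * exp_pi_div_four_mul_omega

lemma norm_G_add_sum_le {x a : ℝ} (hx : 0 < x) (ha : 0 < a) (n : ℕ) :
    ‖G x a + 1 / (2 * Real.pi * Complex.I) * ∑ r ∈ Finset.range n,
      ((Real.Gamma (r + 1 / 2) / Real.Gamma (1 / 2) : ℝ) : ℂ) *
        ((x : ℂ) / (Real.pi * Complex.I)) ^ r * ((a⁻¹ ^ (2 * r + 1) : ℝ) : ℂ)‖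
      ≤ poch (1 / 2) n / (2 * Real.pi) * (x / Real.pi) ^ n * a⁻¹ ^ (2 * n + 1) := by
  have hpq : Real.sqrt (Real.pi / x) = Real.sqrt Real.pi / Real.sqrt x := Real.sqrt_div' _ hx.le
  rw [G_eq_W hx ha, poch, Real.Gamma_one_half_eq, hpq]
  -- With `π = p²` and `x = q²` all the identities below become rational.
  obtain ⟨p, hp, hp2⟩ : ∃ p : ℝ, 0 < p ∧ Real.sqrt Real.pi = p :=
    ⟨_, Real.sqrt_pos.mpr Real.pi_pos, rfl⟩
  obtain ⟨q, hq, hq2⟩ : ∃ q : ℝ, 0 < q ∧ Real.sqrt x = q := ⟨_, Real.sqrt_pos.mpr hx, rfl⟩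
  have hpp : Real.pi = p ^ 2 := by rw [← hp2, Real.sq_sqrt Real.pi_pos.le]
  have hqq : x = q ^ 2 := by rw [← hq2, Real.sq_sqrt hx.le]
  rw [hp2, hq2, hpp, hqq]
  have hτ : 0 < a * (p / q) := by positivity
  have hc : (0 : ℝ) < a * (p / q) / (2 * p ^ 2 * q) := by positivity
  have hp' : (p : ℂ) ≠ 0 := Complex.ofReal_ne_zero.mpr hp.ne'
  have hq' : (q : ℂ) ≠ 0 := Complex.ofReal_ne_zero.mpr hq.ne'
  have ha' : (a : ℂ) ≠ 0 := Complex.ofReal_ne_zero.mpr ha.ne'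
  -- The quotient `(-1)^r / (-1)^(r+1)` gives every term a minus sign, which is why the sum is added
  -- to `G` in the statement.
  have key : ∀ r : ℕ, ((a * (p / q) / (2 * p ^ 2 * q) : ℝ) : ℂ) *
      ((-1) ^ r / (-(Complex.I * ((a * (p / q) : ℝ) : ℂ) ^ 2)) ^ (r + 1)
        * (Real.Gamma (r + 1 / 2) : ℂ))
      = -(1 / (2 * ((p ^ 2 : ℝ) : ℂ) * Complex.I) *
        (((Real.Gamma (r + 1 / 2) / p : ℝ) : ℂ) *
        (((q ^ 2 : ℝ) : ℂ) / (((p ^ 2 : ℝ) : ℂ) * Complex.I)) ^ r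
          * ((a⁻¹ ^ (2 * r + 1) : ℝ) : ℂ))) := by
    intro r
    push_cast
    have hY : Complex.I * ((a : ℂ) * (p / q)) ^ 2 ≠ 0 := by simp [hp.ne', hq.ne', ha.ne']
    have hB : (q : ℂ) ^ 2 / ((p : ℂ) ^ 2 * Complex.I) * (a : ℂ)⁻¹ ^ 2
        = (Complex.I * ((a : ℂ) * (p / q)) ^ 2)⁻¹ := by field_simp
    have hsign : (-1 : ℂ) ^ r / (-(Complex.I * ((a : ℂ) * (p / q)) ^ 2)) ^ (r + 1)
        = -((Complex.I * ((a : ℂ) * (p / q)) ^ 2)⁻¹) ^ (r + 1) := by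
      have h1 : (-1 : ℂ) ^ r ≠ 0 := pow_ne_zero _ (by norm_num)
      rw [neg_pow (Complex.I * _), inv_pow, pow_succ (-1 : ℂ), div_eq_iff (by
        refine mul_ne_zero (mul_ne_zero h1 (by norm_num)) (pow_ne_zero _ hY))]
      have hY' := pow_ne_zero (r + 1) hY
      obtain ⟨Z, hZ⟩ : ∃ Z, (Complex.I * ((a : ℂ) * (p / q)) ^ 2) ^ (r + 1) = Z := ⟨_, rfl⟩
      rw [hZ] at hY' ⊢
      field_simp
    rw [hsign, ← hB]
    obtain ⟨B, hB'⟩ : ∃ B, (q : ℂ) ^ 2 / ((p : ℂ) ^ 2 * Complex.I) = B := ⟨_, rfl⟩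
    rw [hB', mul_pow, pow_succ B r, ← pow_mul, inv_pow, inv_pow]
    nth_rewrite 2 [← hB']
    field_simp
    ring
  rw [Finset.mul_sum]
  have e : ((a * (p / q) : ℝ) : ℂ) / (2 * ((p ^ 2 : ℝ) : ℂ) * (q : ℂ)) * W (a * (p / q))
      + ∑ r ∈ Finset.range n, 1 / (2 * ((p ^ 2 : ℝ) : ℂ) * Complex.I) *
        (((Real.Gamma (r + 1 / 2) / p : ℝ) : ℂ) *
        (((q ^ 2 : ℝ) : ℂ) / (((p ^ 2 : ℝ) : ℂ) * Complex.I)) ^ r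
          * ((a⁻¹ ^ (2 * r + 1) : ℝ) : ℂ))
      = ((a * (p / q) / (2 * p ^ 2 * q) : ℝ) : ℂ) * (W (a * (p / q)) - ∑ r ∈ Finset.range n,
      (-1) ^ r / (-(Complex.I * ((a * (p / q) : ℝ) : ℂ) ^ 2)) ^ (r + 1)
        * (Real.Gamma (r + 1 / 2) : ℂ)) := by
    rw [mul_sub, Finset.mul_sum, Finset.sum_congr rfl fun r _ => key r, Finset.sum_neg_distrib,
      sub_neg_eq_add]
    push_cast
    rfl
  rw [e, norm_mul, Complex.norm_real, Real.norm_of_nonneg hc.le]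
  calc _ ≤ a * (p / q) / (2 * p ^ 2 * q) *
        (Real.Gamma (n + 1 / 2) * ((a * (p / q))⁻¹) ^ (2 * n + 2)) := by
        gcongr
        exact norm_W_sub_sum_le hτ n
    _ = _ := by
      rw [add_comm (1 / 2 : ℝ) (n : ℝ)]
      rw [mul_inv, inv_div, mul_pow, pow_add _ (2 * n), pow_add _ (2 * n), pow_add _ (2 * n),
        pow_mul (q / p), div_pow q p 2]
      field_simp

/-! ### Summing the expansion over shifts -/

lemma hasSum_zeta {r : ℕ} (hr : 1 ≤ r) {a : ℝ} (ha : 0 < a) :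
    HasSum (fun k : ℕ => ((k : ℝ) + a)⁻¹ ^ (2 * r + 1)) (zeta (2 * r + 1) a) := by
  have hr' : (1 : ℝ) ≤ r := by exact_mod_cast hr
  have hs : Summable fun k : ℕ => 1 / |(k : ℝ) + a| ^ (2 * r + 1 : ℝ) :=
    (Real.summable_one_div_nat_add_rpow a _).mpr (by linarith)
  have e : ∀ k : ℕ, 1 / |(k : ℝ) + a| ^ (2 * r + 1 : ℝ) = ((k : ℝ) + a) ^ (-(2 * r + 1 : ℝ)) := by
    intro k
    have hk : 0 < (k : ℝ) + a := by positivity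
    rw [abs_of_pos hk, Real.rpow_neg hk.le, one_div]
  simp_rw [e] at hs
  refine hs.hasSum.congr_fun fun k => ?_
  have hk : 0 < (k : ℝ) + a := by positivity
  rw [Real.rpow_neg hk.le, inv_pow, ← Real.rpow_natCast]
  push_cast
  rfl

lemma hasSum_DeltaPlus {n : ℕ} (hn : 1 ≤ n) {l : ℝ} (hl : |l| < 1) :
    HasSum (fun k : ℕ => ((k : ℝ) + (1 + l))⁻¹ ^ (2 * n + 1) + ((k : ℝ) + (1 - l))⁻¹ ^ (2 * n + 1))
      (DeltaPlus n l) :=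
  (hasSum_zeta hn (by linarith [(abs_lt.mp hl).1])).add
    (hasSum_zeta hn (by linarith [(abs_lt.mp hl).2]))

/-- This is the Mittag-Leffler expansion of the cotangent. At exponent `1` the two zeta series
diverge and only their paired difference converges. -/
lemma hasSum_DeltaMinus_zero {l : ℝ} (hl : |l| < 1) :
    HasSum (fun k : ℕ => ((k : ℝ) + (1 + l))⁻¹ - ((k : ℝ) + (1 - l))⁻¹) (DeltaMinus 0 l) := by
  by_cases h0 : l = 0
  · subst h0
    simp [DeltaMinus, hasSum_zero]
  have hmem : (l : ℂ) ∈ Complex.integerComplement := by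
    rw [Complex.mem_integerComplement_iff]
    rintro ⟨m, hm⟩
    have hm' : (m : ℝ) = l := by exact_mod_cast hm
    rw [← hm'] at hl h0
    have h1 : |m| < 1 := by exact_mod_cast hl
    exact h0 (by rw [Int.abs_lt_one_iff.mp h1]; simp)
  have hs := (summable_cotTerm hmem).hasSum
  rw [← cot_series_rep' hmem] at hs
  rw [← Complex.hasSum_ofReal]
  have hv : ((DeltaMinus 0 l : ℝ) : ℂ) = Real.pi * Complex.cot (Real.pi * l) - 1 / l := by
    simp [DeltaMinus, h0]
  rw [hv]
  refine hs.congr_fun fun k => ?_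
  rw [cotTerm, show (l : ℂ) - (k + 1) = -(k + (1 - l)) by ring, show (l : ℂ) + (k + 1) = k + (1 + l) by ring]
  push_cast
  rw [one_div, one_div, inv_neg]
  ring

lemma hasSum_DeltaMinus (r : ℕ) {l : ℝ} (hl : |l| < 1) :
    HasSum (fun k : ℕ => ((k : ℝ) + (1 + l))⁻¹ ^ (2 * r + 1) - ((k : ℝ) + (1 - l))⁻¹ ^ (2 * r + 1))
      (DeltaMinus r l) := by
  rcases Nat.eq_zero_or_pos r with rfl | hr
  · simpa using hasSum_DeltaMinus_zero hl
  · rw [DeltaMinus, if_neg hr.ne']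
    exact (hasSum_zeta hr (by linarith [(abs_lt.mp hl).1])).sub
      (hasSum_zeta hr (by linarith [(abs_lt.mp hl).2]))

/-- Adding to each `G` its truncated expansion leaves errors of order `k^(-2n-1)`, absolutely
summable since `n ≥ 1`. The truncated expansions are summed separately, in pairs, by
`hasSum_DeltaMinus`. -/
lemma exists_hasSum_G {x : ℝ} (hx : 0 < x) {l : ℝ} (hl : |l| < 1) {n : ℕ} (hn : 1 ≤ n) :
    ∃ T : ℂ, HasSum (fun k : ℕ => G x (k + (1 + l)) - G x (k + (1 - l))) T ∧
      ‖T + 1 / (2 * Real.pi * Complex.I) * ∑ r ∈ Finset.range n,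
        ((Real.Gamma (r + 1 / 2) / Real.Gamma (1 / 2) : ℝ) : ℂ) *
          ((x : ℂ) / (Real.pi * Complex.I)) ^ r * (DeltaMinus r l : ℂ)‖
        ≤ poch (1 / 2) n / (2 * Real.pi) * (x / Real.pi) ^ n * DeltaPlus n l := by
  set main : ℝ → ℂ := fun a => 1 / (2 * Real.pi * Complex.I) * ∑ r ∈ Finset.range n,
      ((Real.Gamma (r + 1 / 2) / Real.Gamma (1 / 2) : ℝ) : ℂ) *
        ((x : ℂ) / (Real.pi * Complex.I)) ^ r * ((a⁻¹ ^ (2 * r + 1) : ℝ) : ℂ) with hmain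
  set Q := 1 / (2 * Real.pi * Complex.I) * ∑ r ∈ Finset.range n,
        ((Real.Gamma (r + 1 / 2) / Real.Gamma (1 / 2) : ℝ) : ℂ) *
          ((x : ℂ) / (Real.pi * Complex.I)) ^ r * (DeltaMinus r l : ℂ)
  have hQ : HasSum (fun k : ℕ => main (k + (1 + l)) - main (k + (1 - l))) Q := by
    have h1 := (hasSum_sum (s := Finset.range n) fun r _ =>
      (Complex.hasSum_ofReal.mpr (hasSum_DeltaMinus r hl)).mul_left
        (((Real.Gamma (r + 1 / 2) / Real.Gamma (1 / 2) : ℝ) : ℂ) *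
          ((x : ℂ) / (Real.pi * Complex.I)) ^ r)).mul_left (1 / (2 * Real.pi * Complex.I))
    refine h1.congr_fun fun k => ?_
    simp only [hmain]
    rw [← mul_sub, ← Finset.sum_sub_distrib]
    congr 1
    refine Finset.sum_congr rfl fun r _ => ?_
    rw [Complex.ofReal_sub, mul_sub]
  have hb := (hasSum_DeltaPlus hn hl).mul_left
    (poch (1 / 2) n / (2 * Real.pi) * (x / Real.pi) ^ n)
  have hle : ∀ k : ℕ, ‖(G x (k + (1 + l)) - G x (k + (1 - l))) +
      (main (k + (1 + l)) - main (k + (1 - l)))‖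
      ≤ poch (1 / 2) n / (2 * Real.pi) * (x / Real.pi) ^ n *
        (((k : ℝ) + (1 + l))⁻¹ ^ (2 * n + 1) + ((k : ℝ) + (1 - l))⁻¹ ^ (2 * n + 1)) := by
    intro k
    have hk : (0 : ℝ) ≤ k := k.cast_nonneg
    have h1 := norm_G_add_sum_le hx (a := k + (1 + l)) (by linarith [(abs_lt.mp hl).1]) n
    have h2 := norm_G_add_sum_le hx (a := k + (1 - l)) (by linarith [(abs_lt.mp hl).2]) n
    rw [mul_add]
    refine le_trans ?_ (add_le_add h1 h2)
    refine le_trans (le_of_eq ?_) (norm_sub_le _ _)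
    congr 1
    simp only [hmain]
    ring
  have hS : Summable fun k : ℕ => (G x (k + (1 + l)) - G x (k + (1 - l))) +
      (main (k + (1 + l)) - main (k + (1 - l))) := .of_norm_bounded hb.summable hle
  refine ⟨_, (hS.hasSum.sub hQ).congr_fun fun k => ?_, ?_⟩
  · ring
  · rw [sub_add_cancel]
    exact tsum_of_norm_bounded hb hle

lemma tendsto_G_atTop {x : ℝ} (hx : 0 < x) : Tendsto (G x) atTop (𝓝 0) := by
  -- The expansion with no terms already gives a bound of order `1 / a`.
  refine squeeze_zero_norm' (a := fun a => poch (1 / 2) 0 / (2 * Real.pi) * (x / Real.pi) ^ 0 *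
    a⁻¹ ^ (2 * 0 + 1)) ?_ ?_
  · filter_upwards [eventually_gt_atTop 0] with a ha
    simpa using norm_G_add_sum_le hx ha 0
  · simpa using (tendsto_inv_atTop_zero (𝕜 := ℝ)).const_mul
      (poch (1 / 2) 0 / (2 * Real.pi))

/-! ### Poisson summation on a finite interval -/

/-- This is `ζ(2)` minus the Fourier series of the Bernoulli polynomial `t² - t + 1/6`. The factor
`1 - cos`, zero at both ends, is the kernel left by two integrations by parts. -/
lemma hasSum_one_sub_cos {t : ℝ} (ht : t ∈ Set.Icc (0 : ℝ) 1) :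
    HasSum (fun n : ℕ => 1 / (n : ℝ) ^ 2 * (1 - Real.cos (2 * Real.pi * n * t)))
      (Real.pi ^ 2 * (t - t ^ 2)) := by
  have h := hasSum_one_div_nat_pow_mul_cos (k := 1) one_ne_zero ht
  have hB : Polynomial.eval t (Polynomial.map (algebraMap ℚ ℝ) (Polynomial.bernoulli (2 * 1)))
      = t ^ 2 - t + 1 / 6 := by
    simp [Polynomial.bernoulli, Finset.sum_range_succ, bernoulli_two]
    ring
  rw [hB] at h
  have h2 := hasSum_zeta_two.sub h
  simp only [mul_one] at h2
  rw [show Real.pi ^ 2 * (t - t ^ 2) = Real.pi ^ 2 / 6 -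
    (-1) ^ (1 + 1) * (2 * Real.pi) ^ 2 / 2 / (Nat.factorial 2 : ℝ) * (t ^ 2 - t + 1 / 6) by
      norm_num [Nat.factorial]; ring]
  exact h2.congr_fun fun n => by ring

/-- The `n`-th symmetric Fourier coefficient after two integrations by parts. -/
lemma integral_two_mul_cos {g g1 g2 : ℝ → ℂ} (h1 : ∀ t, HasDerivAt g (g1 t) t)
    (h2 : ∀ t, HasDerivAt g1 (g2 t) t) (hc : Continuous g2) {n : ℕ} (hn : n ≠ 0) :
    ∫ t in (0 : ℝ)..1, 2 * g t * (Real.cos (2 * Real.pi * n * t) : ℂ)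
      = ∫ t in (0 : ℝ)..1, g2 t * ((1 / (2 * Real.pi ^ 2) *
          (1 / (n : ℝ) ^ 2 * (1 - Real.cos (2 * Real.pi * n * t))) : ℝ) : ℂ) := by
  have hg : Continuous g := continuous_iff_continuousAt.mpr fun t => (h1 t).continuousAt
  obtain ⟨a, ha⟩ : ∃ a : ℝ, 2 * Real.pi * n = a := ⟨_, rfl⟩
  have ha0 : a ≠ 0 := by
    rw [← ha]; exact mul_ne_zero (by positivity) (Nat.cast_ne_zero.mpr hn)
  have ha0' : (a : ℂ) ≠ 0 := Complex.ofReal_ne_zero.mpr ha0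
  have hcoef : ∀ y : ℝ, 1 / (2 * Real.pi ^ 2) * (1 / (n : ℝ) ^ 2 * y) = 2 / a ^ 2 * y := by
    intro y
    have := Real.pi_ne_zero
    have hn' : (n : ℝ) ≠ 0 := Nat.cast_ne_zero.mpr hn
    rw [← ha]
    field_simp
  have hcos : Real.cos a = 1 := by
    rw [← ha, show 2 * Real.pi * n = n * (2 * Real.pi) by ring, Real.cos_nat_mul_two_pi]
  have hsin : Real.sin a = 0 := by
    rw [← ha, show 2 * Real.pi * n = ((2 * n : ℕ) : ℝ) * Real.pi by push_cast; ring,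
      Real.sin_nat_mul_pi]
  simp_rw [ha, hcoef]
  have hc1 : Continuous fun t : ℝ => 2 * g t * (Real.cos (a * t) : ℂ) := by fun_prop
  have hc2 : Continuous fun t : ℝ => g2 t * ((2 / a ^ 2 * (1 - Real.cos (a * t)) : ℝ) : ℂ) := by
    fun_prop
  rw [← sub_eq_zero, ← intervalIntegral.integral_sub (hc1.intervalIntegrable _ _)
    (hc2.intervalIntegrable _ _)]
  have hc12 : Continuous fun t : ℝ => 2 * g t * (Real.cos (a * t) : ℂ)
      - g2 t * ((2 / a ^ 2 * (1 - Real.cos (a * t)) : ℝ) : ℂ) := hc1.sub hc2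
  -- Choosing `cos - 1` as the second primitive makes the boundary terms vanish at both ends.
  rw [intervalIntegral.integral_eq_sub_of_hasDerivAt (f := fun t : ℝ =>
    g t * ((2 / a * Real.sin (a * t) : ℝ) : ℂ) + g1 t * ((2 / a ^ 2 * (Real.cos (a * t) - 1) : ℝ) : ℂ))
    (fun t _ => ?_) (hc12.intervalIntegrable _ _)]
  · simp [hcos, hsin]
  · have hat : HasDerivAt (fun t : ℝ => a * t) a t := by simpa using (hasDerivAt_id t).const_mul a
    refine (((h1 t).mul ((hat.sin.const_mul (2 / a)).ofReal_comp)).add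
      ((h2 t).mul (((hat.cos.sub_const 1).const_mul (2 / a ^ 2)).ofReal_comp))).congr_deriv ?_
    push_cast
    field_simp
    ring

/-- Two integrations by parts gain a factor `n⁻²`, which justifies summing under the integral. The
result `∫ g2 (t - t²) / 2` is then integrated by parts back to the trapezoidal error. -/
lemma hasSum_fourier_unit_interval {g g1 g2 : ℝ → ℂ} (h1 : ∀ t, HasDerivAt g (g1 t) t)
    (h2 : ∀ t, HasDerivAt g1 (g2 t) t) (hc : Continuous g2) :
    HasSum (fun n : ℕ => ∫ t in (0 : ℝ)..1,
        2 * g t * (Real.cos (2 * Real.pi * (n + 1 : ℕ) * t) : ℂ))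
      ((g 0 + g 1) / 2 - ∫ t in (0 : ℝ)..1, g t) := by
  have hg : Continuous g := continuous_iff_continuousAt.mpr fun t => (h1 t).continuousAt
  have key : HasSum (fun n : ℕ => ∫ t in (0 : ℝ)..1, g2 t * ((1 / (2 * Real.pi ^ 2) *
          (1 / (n : ℝ) ^ 2 * (1 - Real.cos (2 * Real.pi * n * t))) : ℝ) : ℂ))
      (∫ t in (0 : ℝ)..1, g2 t * ((1 / (2 * Real.pi ^ 2) * (Real.pi ^ 2 * (t - t ^ 2)) : ℝ) : ℂ)) := by
    refine intervalIntegral.hasSum_integral_of_dominated_convergence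
      (fun n t => ‖g2 t‖ * (1 / (2 * Real.pi ^ 2)) * 2 * (1 / (n : ℝ) ^ 2)) ?_ ?_ ?_ ?_ ?_
    · intro n
      exact Continuous.aestronglyMeasurable (by fun_prop)
    · refine fun n => Eventually.of_forall fun t _ => ?_
      rw [norm_mul, Complex.norm_real]
      have hb : 0 ≤ 1 - Real.cos (2 * Real.pi * n * t) := by linarith [Real.cos_le_one (2 * Real.pi * n * t)]
      have hb2 : 1 - Real.cos (2 * Real.pi * n * t) ≤ 2 := by
        linarith [Real.neg_one_le_cos (2 * Real.pi * n * t)]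
      rw [Real.norm_of_nonneg (by positivity)]
      calc _ ≤ ‖g2 t‖ * (1 / (2 * Real.pi ^ 2) * (1 / (n : ℝ) ^ 2 * 2)) := by gcongr
        _ = _ := by ring
    · exact Eventually.of_forall fun t _ => hasSum_zeta_two.summable.mul_left _
    · simp_rw [tsum_mul_left]
      exact Continuous.intervalIntegrable (by fun_prop) _ _
    · refine Eventually.of_forall fun t ht => ?_
      rw [Set.uIoc_of_le zero_le_one] at ht
      exact (Complex.hasSum_ofReal.mpr
        ((hasSum_one_sub_cos ⟨ht.1.le, ht.2⟩).mul_left _)).mul_left _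
  -- The dropped term `n = 0` is zero, as `1 / 0 = 0`.
  rw [← hasSum_nat_add_iff' 1] at key
  have hval : (g 0 + g 1) / 2 - ∫ t in (0 : ℝ)..1, g t =
      (∫ t in (0 : ℝ)..1, g2 t * ((1 / (2 * Real.pi ^ 2) * (Real.pi ^ 2 * (t - t ^ 2)) : ℝ) : ℂ)) -
      ∑ i ∈ Finset.range 1, ∫ t in (0 : ℝ)..1, g2 t * ((1 / (2 * Real.pi ^ 2) *
          (1 / (i : ℝ) ^ 2 * (1 - Real.cos (2 * Real.pi * i * t))) : ℝ) : ℂ) := by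
    have e : ∀ t : ℝ, 1 / (2 * Real.pi ^ 2) * (Real.pi ^ 2 * (t - t ^ 2)) = (t - t ^ 2) / 2 := by
      intro t
      have := Real.pi_ne_zero
      field_simp
    simp_rw [e]
    simp only [Finset.range_one, Finset.sum_singleton, CharP.cast_eq_zero, ne_eq,
      OfNat.ofNat_ne_zero, not_false_eq_true, zero_pow, div_zero, zero_mul, mul_zero,
      Complex.ofReal_zero, intervalIntegral.integral_zero, sub_zero]
    have hc2 : Continuous fun t : ℝ => g2 t * (((t - t ^ 2) / 2 : ℝ) : ℂ) := by fun_prop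
    have h := intervalIntegral.integral_eq_sub_of_hasDerivAt (a := 0) (b := 1)
      (f := fun t : ℝ => g1 t * (((t - t ^ 2) / 2 : ℝ) : ℂ) - g t * (((1 - 2 * t) / 2 : ℝ) : ℂ))
      (f' := fun t : ℝ => g2 t * (((t - t ^ 2) / 2 : ℝ) : ℂ) + g t) (fun t _ => ?_)
      ((hc2.add hg).intervalIntegrable _ _)
    · rw [intervalIntegral.integral_add (hc2.intervalIntegrable _ _) (hg.intervalIntegrable _ _)] at h
      rw [eq_sub_of_add_eq h]
      norm_num
      ring
    · have d1 : HasDerivAt (fun t : ℝ => (t - t ^ 2) / 2) ((1 - 2 * t) / 2) t := by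
        simpa using ((hasDerivAt_id t).sub (hasDerivAt_pow 2 t)).div_const 2
      have d2 : HasDerivAt (fun t : ℝ => (1 - 2 * t) / 2) (-1) t := by
        refine ((((hasDerivAt_id t).const_mul 2).const_sub 1).div_const 2).congr_deriv ?_
        norm_num
      refine (((h2 t).mul d1.ofReal_comp).sub ((h1 t).mul d2.ofReal_comp)).congr_deriv ?_
      push_cast
      ring
  rw [hval]
  exact key.congr_fun fun n => integral_two_mul_cos h1 h2 hc n.succ_ne_zero

/-- Poisson summation on `[0, N]` for twice differentiable functions. -/
lemma hasSum_fourier_interval {g g1 g2 : ℝ → ℂ} (h1 : ∀ t, HasDerivAt g (g1 t) t)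
    (h2 : ∀ t, HasDerivAt g1 (g2 t) t) (hc : Continuous g2) (N : ℕ) :
    HasSum (fun n : ℕ => ∫ t in (0 : ℝ)..N,
        2 * g t * (Real.cos (2 * Real.pi * (n + 1 : ℕ) * t) : ℂ))
      (∑ j ∈ Finset.range N, (g j + g (j + 1)) / 2 - ∫ t in (0 : ℝ)..N, g t) := by
  have hg : Continuous g := continuous_iff_continuousAt.mpr fun t => (h1 t).continuousAt
  have hadj : ∀ {h : ℝ → ℂ}, Continuous h →
      ∫ t in (0 : ℝ)..N, h t = ∑ j ∈ Finset.range N, ∫ t in (0 : ℝ)..1, h (j + t) := by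
    intro h hh
    have := intervalIntegral.sum_integral_adjacent_intervals (f := h) (μ := volume)
      (a := fun j : ℕ => (j : ℝ)) (n := N) fun k _ => hh.intervalIntegrable _ _
    rw [Nat.cast_zero] at this
    rw [← this]
    refine Finset.sum_congr rfl fun j _ => ?_
    rw [intervalIntegral.integral_comp_add_left h]
    push_cast
    rw [add_zero]
  have hj : ∀ j ∈ Finset.range N, HasSum (fun n : ℕ => ∫ t in (0 : ℝ)..1,
      2 * g (j + t) * (Real.cos (2 * Real.pi * (n + 1 : ℕ) * t) : ℂ))
      ((g j + g (j + 1)) / 2 - ∫ t in (0 : ℝ)..1, g (j + t)) := by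
    intro j _
    have := hasSum_fourier_unit_interval (g := fun t => g (j + t)) (g1 := fun t => g1 (j + t))
      (g2 := fun t => g2 (j + t)) (fun t => HasDerivAt.comp_const_add _ _ (h1 _))
      (fun t => HasDerivAt.comp_const_add _ _ (h2 _)) (by fun_prop)
    simpa using this
  have := hasSum_sum hj
  rw [Finset.sum_sub_distrib, ← hadj hg] at this
  refine this.congr_fun fun n => ?_
  rw [hadj (by fun_prop)]
  refine Finset.sum_congr rfl fun j _ => ?_
  congr 1
  ext t
  rw [show 2 * Real.pi * ((n + 1 : ℕ) : ℝ) * (j + t)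
    = 2 * Real.pi * ((n + 1 : ℕ) : ℝ) * t + ((j * (n + 1) : ℕ) : ℝ) * (2 * Real.pi) by
      push_cast; ring, Real.cos_add_nat_mul_two_pi]

/-! ### Poisson summation applied to the Gauss sum -/

lemma hasDerivAt_f (x θ t : ℝ) :
    HasDerivAt (f x θ) ((2 * Real.pi * Complex.I * x * t + 2 * Real.pi * Complex.I * θ) * f x θ t) t := by
  have hs : HasDerivAt (fun s : ℝ => (s : ℂ)) 1 t := (hasDerivAt_id (t : ℂ)).comp_ofReal
  have := (((hs.pow 2).const_mul (Real.pi * Complex.I * x)).add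
    (hs.const_mul (2 * Real.pi * Complex.I * θ))).cexp
  refine this.congr_deriv ?_
  simp only [f, Pi.add_apply, Pi.pow_apply]
  push_cast
  ring

lemma continuous_f (x θ : ℝ) : Continuous (f x θ) :=
  continuous_iff_continuousAt.mpr fun t => (hasDerivAt_f x θ t).continuousAt

lemma f_sub_eq (x θ b t : ℝ) :
    f x (θ - b) t = f x θ t * Complex.exp (-(2 * Real.pi * b * t) * Complex.I) := by
  rw [f, f, ← Complex.exp_add]
  congr 1
  push_cast
  ring

lemma sum_trapezoid_f (x θ : ℝ) (N : ℕ) :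
    ∑ j ∈ Finset.range N, (f x θ j + f x θ (j + 1)) / 2 = S N x θ - 1 / 2 * (f x θ N - 1) := by
  induction N with
  | zero => simp [S, f]
  | succ N ih =>
    rw [Finset.sum_range_succ, ih, S, S, Finset.sum_Icc_succ_top (by omega)]
    push_cast
    ring

/-- Splitting `2 cos` into two exponentials shifts `θ` by `±(m + 1)`. -/
lemma hasSum_integral_f (x θ : ℝ) (N : ℕ) :
    HasSum (fun m : ℕ => (∫ t in (0 : ℝ)..N, f x (θ - (m + 1)) t)
        + ∫ t in (0 : ℝ)..N, f x (θ + (m + 1)) t)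
      (S N x θ - 1 / 2 * (f x θ N - 1) - ∫ t in (0 : ℝ)..N, f x θ t) := by
  have hlin : ∀ t : ℝ, HasDerivAt (fun t : ℝ =>
      2 * Real.pi * Complex.I * x * (t : ℂ) + 2 * Real.pi * Complex.I * θ)
      (2 * Real.pi * Complex.I * x) t := by
    intro t
    have hs : HasDerivAt (fun s : ℝ => (s : ℂ)) 1 t := (hasDerivAt_id (t : ℂ)).comp_ofReal
    simpa using (hs.const_mul (2 * Real.pi * Complex.I * x)).add_const (2 * Real.pi * Complex.I * θ)
  have hf := continuous_f x θ
  have h := hasSum_fourier_interval (hasDerivAt_f x θ)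
    (fun t => (hlin t).mul (hasDerivAt_f x θ t)) (by fun_prop) N
  rw [sum_trapezoid_f] at h
  refine h.congr_fun fun m => ?_
  rw [← intervalIntegral.integral_add ((continuous_f _ _).intervalIntegrable _ _)
    ((continuous_f _ _).intervalIntegrable _ _)]
  congr 1
  ext t
  rw [← sub_neg_eq_add θ, f_sub_eq, f_sub_eq, Complex.ofReal_cos, Complex.cos, ← mul_add]
  push_cast
  rw [show -(2 * (Real.pi : ℂ) * -((m : ℂ) + 1) * t) = 2 * Real.pi * (m + 1) * t by ring]
  ring

/-- Completing the square gives a primitive proportional to `erfc (ω (x t + b) √(π/x))`, whatever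
the sign of `b`. At the upper end, `f x b N` absorbs the change of exponential prefactor. -/
lemma integral_f_eq_G {x : ℝ} (hx : 0 < x) (b : ℝ) (N : ℕ) :
    ∫ t in (0 : ℝ)..N, f x b t = G x b - f x b N * G x (N * x + b) := by
  have hp0 : (0 : ℝ) < Real.sqrt Real.pi := Real.sqrt_pos.mpr Real.pi_pos
  have hq0 : (0 : ℝ) < Real.sqrt x := Real.sqrt_pos.mpr hx
  have hp' : (Real.sqrt Real.pi : ℂ) ≠ 0 := Complex.ofReal_ne_zero.mpr hp0.ne'
  have hq' : (Real.sqrt x : ℂ) ≠ 0 := Complex.ofReal_ne_zero.mpr hq0.ne'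
  have hx' : (x : ℂ) ≠ 0 := Complex.ofReal_ne_zero.mpr hx.ne'
  have hqq : (x : ℂ) = (Real.sqrt x : ℂ) ^ 2 := by exact_mod_cast (Real.sq_sqrt hx.le).symm
  have hpq : Real.sqrt (Real.pi / x) = Real.sqrt Real.pi / Real.sqrt x := Real.sqrt_div' _ hx.le
  have hsq : ∀ y : ℝ, -(omega * ((y * Real.sqrt (Real.pi / x) : ℝ) : ℂ)) ^ 2
      = Real.pi * Complex.I * y ^ 2 / x := by
    intro y
    have h : (Real.sqrt (Real.pi / x) : ℂ) ^ 2 = Real.pi / x := by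
      exact_mod_cast Real.sq_sqrt (div_pos Real.pi_pos hx).le
    push_cast
    rw [mul_pow, mul_pow, omega_sq, h]
    ring
  set K : ℂ := Complex.exp (Real.pi * Complex.I / 4) / (2 * (Real.sqrt x : ℂ)) with hK
  set P : ℝ → ℂ := fun t => -(K * Complex.exp (-(Real.pi * Complex.I * b ^ 2 / x)) *
    erfc (omega * (((x * t + b) * Real.sqrt (Real.pi / x) : ℝ) : ℂ))) with hP
  have hd : ∀ t : ℝ, HasDerivAt P (f x b t) t := by
    intro t
    have hin : HasDerivAt (fun t : ℝ => (x * t + b) * Real.sqrt (Real.pi / x))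
        (x * Real.sqrt (Real.pi / x)) t := by
      simpa using (((hasDerivAt_id t).const_mul x).add_const b).mul_const (Real.sqrt (Real.pi / x))
    have h := ((hasDerivAt_erfc_ofReal_mul omega _).scomp t hin).const_mul
      (K * Complex.exp (-(Real.pi * Complex.I * b ^ 2 / x)))
    refine h.neg.congr_deriv ?_
    have hfe : f x b t = Complex.exp (-(Real.pi * Complex.I * b ^ 2 / x)) *
        Complex.exp (Real.pi * Complex.I * ((x * t + b : ℝ) : ℂ) ^ 2 / x) := by
      rw [f, ← Complex.exp_add]
      congr 1
      push_cast
      field_simp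
      ring
    rw [hsq, hfe, Complex.real_smul, hpq, hK]
    have hcst : ((x * (Real.sqrt Real.pi / Real.sqrt x) : ℝ) : ℂ)
        = (Real.sqrt x : ℂ) * (Real.sqrt Real.pi : ℂ) := by
      push_cast
      nth_rewrite 1 [hqq]
      field_simp
    rw [hcst]
    field_simp
    exact exp_pi_div_four_mul_omega
  rw [intervalIntegral.integral_eq_sub_of_hasDerivAt (fun t _ => hd t)
    ((continuous_f x b).intervalIntegrable _ _)]
  have hE : ∀ y : ℝ, E x y = Complex.exp (-(Real.pi * Complex.I * y ^ 2 / x)) *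
      erfc (omega * ((y * Real.sqrt (Real.pi / x) : ℝ) : ℂ)) := by
    intro y
    rw [E, omega]
    push_cast
    rw [mul_assoc (Complex.exp _) (y : ℂ)]
  have hfN : f x b N * Complex.exp (-(Real.pi * Complex.I * ((N * x + b : ℝ) : ℂ) ^ 2 / x))
      = Complex.exp (-(Real.pi * Complex.I * b ^ 2 / x)) := by
    rw [f, ← Complex.exp_add]
    congr 1
    push_cast
    field_simp
    ring
  rw [G, G, ← hK, hE, hE, show f x b N * (K * (Complex.exp (-(Real.pi * Complex.I *
      ((N * x + b : ℝ) : ℂ) ^ 2 / x)) *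
      erfc (omega * (((N * x + b) * Real.sqrt (Real.pi / x) : ℝ) : ℂ))))
      = K * (f x b N * Complex.exp (-(Real.pi * Complex.I * ((N * x + b : ℝ) : ℂ) ^ 2 / x))) *
        erfc (omega * (((N * x + b) * Real.sqrt (Real.pi / x) : ℝ) : ℂ)) by ring, hfN]
  simp only [hP]
  rw [mul_zero, zero_add, mul_comm x (N : ℝ)]
  ring

/-! ### Stationary terms and integer shifts -/

/-- The complete oscillatory integral `∫_{-∞}^∞ exp(π i x t² + 2 π i a t) dt`, in closed form. -/
def stationaryTerm (x a : ℝ) : ℂ :=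
  Complex.exp (Real.pi * Complex.I / 4) / (Real.sqrt x : ℂ) *
    Complex.exp (-(Real.pi * Complex.I * a ^ 2 / x))

/-- The `2` in `erfc (-z) = 2 - erfc z` becomes the full-line integral. -/
lemma G_neg (x a : ℝ) : G x (-a) = stationaryTerm x a - G x a := by
  have h : Complex.exp (-(Real.pi * Complex.I / 4)) * ((-a : ℝ) : ℂ) * (Real.sqrt (Real.pi / x) : ℂ)
      = -(Complex.exp (-(Real.pi * Complex.I / 4)) * a * (Real.sqrt (Real.pi / x) : ℂ)) := by
    push_cast; ring
  rw [G, G, E, E, h, erfc_neg, stationaryTerm]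
  push_cast
  rw [neg_sq, mul_comm 2 (Real.sqrt x : ℂ), ← div_div]
  ring

lemma stationaryTerm_neg (x a : ℝ) : stationaryTerm x (-a) = stationaryTerm x a := by
  rw [stationaryTerm, stationaryTerm]
  push_cast
  rw [neg_sq]

/-- The exponents differ by `2πi k N`, a period because `k` and `N` are integers. -/
lemma f_mul_stationaryTerm {x : ℝ} (hx : 0 < x) (θ : ℝ) (N : ℕ) (k : ℤ) :
    f x θ N * stationaryTerm x (N * x + θ - k) = stationaryTerm x (θ - k) := by
  have hx' : (x : ℂ) ≠ 0 := Complex.ofReal_ne_zero.mpr hx.ne'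
  rw [stationaryTerm, stationaryTerm, mul_left_comm, f, ← Complex.exp_add]
  congr 1
  rw [Complex.exp_eq_exp_iff_exists_int]
  refine ⟨k * N, ?_⟩
  push_cast
  field_simp
  ring

lemma f_sub_int (x θ : ℝ) (k : ℤ) (N : ℕ) : f x (θ - k) N = f x θ N := by
  rw [f, f, Complex.exp_eq_exp_iff_exists_int]
  refine ⟨-(k * N), ?_⟩
  push_cast
  ring

/-- Symmetric partial sums of `G` over `a + ℤ`, with the stationary terms removed. -/
def symSum (x a : ℝ) (K : ℕ) : ℂ :=
  G x a + ∑ m ∈ Finset.range K, (G x (m + (1 + a)) - G x (m + (1 - a)))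

/-- Shifting `a` by one displaces the window by one step. Reflecting `G x (-a)` costs one stationary
term, and the two boundary values of `G` tend to zero as `K` grows. -/
lemma symSum_add_one (x a : ℝ) (K : ℕ) :
    symSum x (a + 1) K = symSum x a K - stationaryTerm x a + (G x (K + (1 + a)) + G x (K - a)) := by
  induction K with
  | zero =>
    have := G_neg x a
    simp only [symSum, Finset.range_zero, Finset.sum_empty, add_zero, CharP.cast_eq_zero, zero_add,
      zero_sub, this]
    rw [add_comm a 1]
    ring
  | succ K ih =>
    rw [symSum] at ih
    rw [symSum, symSum, Finset.sum_range_succ, Finset.sum_range_succ, ← add_assoc, ih, symSum]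
    push_cast
    rw [show (K : ℝ) + (1 + (a + 1)) = K + 1 + (1 + a) by ring,
      show (K : ℝ) + (1 - (a + 1)) = K - a by ring, show (K : ℝ) + 1 - a = K + (1 - a) by ring]
    ring

lemma tendsto_symSum_add_nat {x : ℝ} (hx : 0 < x) {a : ℝ} {L : ℂ}
    (h : Tendsto (symSum x a) atTop (𝓝 L)) (M : ℕ) :
    Tendsto (symSum x (a + M)) atTop
      (𝓝 (L - ∑ j ∈ Finset.range M, stationaryTerm x (a + j))) := by
  induction M with
  | zero => simpa using h
  | succ M ih =>
    have h1 : Tendsto (fun K : ℕ => G x (K + (1 + (a + M)))) atTop (𝓝 0) :=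
      (tendsto_G_atTop hx).comp
        (tendsto_atTop_add_const_right _ _ tendsto_natCast_atTop_atTop)
    have h2 : Tendsto (fun K : ℕ => G x (K - (a + M))) atTop (𝓝 0) :=
      (tendsto_G_atTop hx).comp
        (tendsto_atTop_add_const_right _ _ tendsto_natCast_atTop_atTop)
    have h3 := (ih.sub_const (stationaryTerm x (a + M))).add (h1.add h2)
    rw [Finset.sum_range_succ, ← sub_sub, ← add_zero (_ - _ : ℂ), ← add_zero (0 : ℂ)]
    push_cast
    rw [← add_assoc a (M : ℝ) 1]
    exact h3.congr fun K => (symSum_add_one x (a + M) K).symm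

/-- Symmetric partial sums of `G` over `a + ℤ`. -/
lemma symSum_add_stationary (x a : ℝ) (K : ℕ) :
    G x a + ∑ m ∈ Finset.range K, (G x (a - (m + 1)) + G x (a + (m + 1)))
      = symSum x a K + ∑ m ∈ Finset.range K, stationaryTerm x (a - (m + 1)) := by
  rw [symSum, add_assoc, ← Finset.sum_add_distrib]
  congr 1
  refine Finset.sum_congr rfl fun m _ => ?_
  rw [← stationaryTerm_neg, show a - ((m : ℝ) + 1) = -(m + (1 - a)) by ring, G_neg, neg_neg,
    show a + ((m : ℝ) + 1) = m + (1 + a) by ring]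
  ring

/-- The stationary terms at `θ - k` and `N x + θ - k` cancel for each finite `K`, before the limit
is taken, so no divergent sum arises. -/
lemma tendsto_symSum_sub (x θ : ℝ) (hx : 0 < x) (N : ℕ) :
    Tendsto (fun K => symSum x θ K - f x θ N * symSum x (N * x + θ) K) atTop
      (𝓝 (S N x θ - 1 / 2 * (f x θ N - 1))) := by
  have h := ((hasSum_integral_f x θ N).tendsto_sum_nat).const_add (∫ t in (0 : ℝ)..N, f x θ t)
  rw [add_sub_cancel] at h
  refine h.congr fun K => ?_
  have hm : ∀ m : ℕ, f x (θ - (m + 1)) N = f x θ N := fun m => by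
    simpa using f_sub_int x θ (m + 1) N
  have hm' : ∀ m : ℕ, f x (θ + (m + 1)) N = f x θ N := fun m => by
    have := f_sub_int x θ (-(m + 1)) N
    push_cast at this
    rwa [sub_neg_eq_add] at this
  have hst : f x θ N * ∑ m ∈ Finset.range K, stationaryTerm x (N * x + θ - (m + 1))
      = ∑ m ∈ Finset.range K, stationaryTerm x (θ - (m + 1)) := by
    rw [Finset.mul_sum]
    refine Finset.sum_congr rfl fun m _ => ?_
    simpa using f_mul_stationaryTerm hx θ N (m + 1)
  have e1 := symSum_add_stationary x θ K
  have e2 := symSum_add_stationary x (N * x + θ) K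
  have e3 : (∫ t in (0 : ℝ)..N, f x θ t) + ∑ m ∈ Finset.range K,
      ((∫ t in (0 : ℝ)..N, f x (θ - (m + 1)) t) + ∫ t in (0 : ℝ)..N, f x (θ + (m + 1)) t)
      = (G x θ + ∑ m ∈ Finset.range K, (G x (θ - (m + 1)) + G x (θ + (m + 1))))
        - f x θ N * (G x (N * x + θ) + ∑ m ∈ Finset.range K,
          (G x (N * x + θ - (m + 1)) + G x (N * x + θ + (m + 1)))) := by
    rw [integral_f_eq_G hx, mul_add, Finset.mul_sum, add_sub_add_comm, ← Finset.sum_sub_distrib]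
    congr 1
    refine Finset.sum_congr rfl fun m _ => ?_
    rw [integral_f_eq_G hx, integral_f_eq_G hx, hm, hm',
      show (N : ℝ) * x + (θ - (m + 1)) = N * x + θ - (m + 1) by ring,
      show (N : ℝ) * x + (θ + (m + 1)) = N * x + θ + (m + 1) by ring]
    ring
  rw [e3, e1, e2]
  linear_combination -hst

/-! ### The dual sum and the final assembly -/

lemma norm_f (x θ t : ℝ) : ‖f x θ t‖ = 1 := by
  rw [f, show (Real.pi : ℂ) * Complex.I * x * t ^ 2 + 2 * Real.pi * Complex.I * θ * t
    = ((Real.pi * x * t ^ 2 + 2 * Real.pi * θ * t : ℝ) : ℂ) * Complex.I by push_cast; ring,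
    Complex.norm_exp_ofReal_mul_I]

lemma stationaryTerm_sub_eq (x θ k : ℝ) :
    stationaryTerm x (θ - k) = Complex.exp (-(Real.pi * Complex.I * θ ^ 2 / x) + Real.pi * Complex.I / 4)
      / (Real.sqrt x : ℂ) * f (-(1 / x)) (θ / x) k := by
  rw [stationaryTerm, f, div_mul_eq_mul_div, div_mul_eq_mul_div, ← Complex.exp_add,
    ← Complex.exp_add]
  congr 2
  push_cast
  ring

lemma sum_stationaryTerm_eq_S (x θ : ℝ) (M : ℕ) :
    ∑ j ∈ Finset.range M, stationaryTerm x (θ - M + j)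
      = Complex.exp (-(Real.pi * Complex.I * θ ^ 2 / x) + Real.pi * Complex.I / 4)
      / (Real.sqrt x : ℂ) * S M (-(1 / x)) (θ / x) := by
  -- Reversing the order matches the shifts `M - j`, `0 ≤ j < M`, with the indices `1, …, M` of the
  -- dual sum.
  rw [S, Finset.mul_sum, ← Finset.sum_range_reflect, Finset.range_eq_Ico,
    ← Finset.Ico_add_one_right_eq_Icc, ← Finset.sum_Ico_add' _ 0 M 1]
  refine Finset.sum_congr rfl fun j hj => ?_
  rw [← stationaryTerm_sub_eq]
  have hj' : j + 1 ≤ M := (Finset.mem_Ico.mp hj).2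
  rw [Nat.sub_sub, Nat.cast_sub (by omega)]
  congr 1
  push_cast
  ring

end

end QuadGauss

open Filter Topology in
theorem theorem1 (x θ : ℝ) (hx0 : 0 < x) (hx1 : x < 1)
    (hθ0 : -(1 / 2) ≤ θ) (hθ1 : θ ≤ 1 / 2)
    (N : ℕ) (hN : 1 ≤ N)
    (ξ : ℝ) (hξ : ξ = N * x + θ)
    (M : ℤ) (ε : ℝ) (hε : ε = ξ - M) (hε0 : -(1 / 2) < ε) (hε1 : ε ≤ 1 / 2)
    (hM : 0 ≤ M)
    (n : ℕ) (hn : 1 ≤ n) :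
    ∃ R : ℂ,
      QuadGauss.S N x θ
          - Complex.exp (-(Real.pi * Complex.I * θ ^ 2 / x) + Real.pi * Complex.I / 4)
              / (Real.sqrt x : ℂ) * QuadGauss.S M.toNat (-(1 / x)) (θ / x)
          - 1 / 2 * (QuadGauss.f x θ N - 1)
          - Complex.exp (Real.pi * Complex.I / 4) / (2 * (Real.sqrt x : ℂ))
              * (QuadGauss.E x θ - QuadGauss.f x θ N * QuadGauss.E x ε)
        = 1 / (2 * Real.pi * Complex.I)
            * ∑ r ∈ Finset.range n,
                ((Real.Gamma (r + 1 / 2) / Real.Gamma (1 / 2) : ℝ) : ℂ)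
                  * ((x : ℂ) / (Real.pi * Complex.I)) ^ r * QuadGauss.C x θ N ε r
          + R
      ∧ ‖R‖ ≤ QuadGauss.poch (1 / 2) n / (2 * Real.pi) * (x / Real.pi) ^ n
            * (QuadGauss.DeltaPlus n ε + QuadGauss.DeltaPlus n θ) := by
  lift M to ℕ using hM
  rw [Int.toNat_natCast]
  have hεabs : |ε| < 1 := abs_lt.mpr ⟨by linarith, by linarith⟩
  have hθabs : |θ| < 1 := abs_lt.mpr ⟨by linarith, by linarith⟩
  obtain ⟨Tθ, hTθ, hTθ'⟩ := QuadGauss.exists_hasSum_G hx0 hθabs hn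
  obtain ⟨Tε, hTε, hTε'⟩ := QuadGauss.exists_hasSum_G hx0 hεabs hn
  have hlimθ : Tendsto (QuadGauss.symSum x θ) atTop (𝓝 (QuadGauss.G x θ + Tθ)) :=
    hTθ.tendsto_sum_nat.const_add _
  have hlimε : Tendsto (QuadGauss.symSum x ε) atTop (𝓝 (QuadGauss.G x ε + Tε)) :=
    hTε.tendsto_sum_nat.const_add _
  have hlimξ := QuadGauss.tendsto_symSum_add_nat hx0 hlimε M
  have hεM : ε + M = N * x + θ := by rw [hε, hξ]; push_cast; ring
  rw [hεM] at hlimξ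
  -- One limit is evaluated twice: by Poisson summation, and through the convergent series at `θ`
  -- and `ε`.
  have huniq := tendsto_nhds_unique (QuadGauss.tendsto_symSum_sub x θ hx0 N)
    (hlimθ.sub (hlimξ.const_mul (QuadGauss.f x θ N)))
  have hst : QuadGauss.f x θ N * ∑ j ∈ Finset.range M, QuadGauss.stationaryTerm x (ε + j)
      = Complex.exp (-(Real.pi * Complex.I * θ ^ 2 / x) + Real.pi * Complex.I / 4)
              / (Real.sqrt x : ℂ) * QuadGauss.S M (-(1 / x)) (θ / x) := by
    rw [← QuadGauss.sum_stationaryTerm_eq_S, Finset.mul_sum]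
    refine Finset.sum_congr rfl fun j _ => ?_
    -- The integer shift is `k = M - j`, since `ε + j = N x + θ - (M - j)`.
    have := QuadGauss.f_mul_stationaryTerm hx0 θ N (M - j)
    push_cast at this
    rw [show ε + (j : ℝ) = N * x + θ - (M - j) by rw [← hεM]; ring, this]
    congr 1
    ring
  have hlhs : QuadGauss.S N x θ
          - Complex.exp (-(Real.pi * Complex.I * θ ^ 2 / x) + Real.pi * Complex.I / 4)
              / (Real.sqrt x : ℂ) * QuadGauss.S M (-(1 / x)) (θ / x)
          - 1 / 2 * (QuadGauss.f x θ N - 1)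
          - Complex.exp (Real.pi * Complex.I / 4) / (2 * (Real.sqrt x : ℂ))
              * (QuadGauss.E x θ - QuadGauss.f x θ N * QuadGauss.E x ε)
      = Tθ - QuadGauss.f x θ N * Tε := by
    rw [← hst]
    simp only [QuadGauss.G] at huniq
    linear_combination huniq
  set Q : ℝ → ℂ := fun l => 1 / (2 * Real.pi * Complex.I) * ∑ r ∈ Finset.range n,
        ((Real.Gamma (r + 1 / 2) / Real.Gamma (1 / 2) : ℝ) : ℂ) *
          ((x : ℂ) / (Real.pi * Complex.I)) ^ r * (QuadGauss.DeltaMinus r l : ℂ) with hQ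
  have hC : 1 / (2 * Real.pi * Complex.I)
            * ∑ r ∈ Finset.range n,
                ((Real.Gamma (r + 1 / 2) / Real.Gamma (1 / 2) : ℝ) : ℂ)
                  * ((x : ℂ) / (Real.pi * Complex.I)) ^ r * QuadGauss.C x θ N ε r
      = QuadGauss.f x θ N * Q ε - Q θ := by
    simp only [hQ]
    rw [mul_left_comm, ← mul_sub, Finset.mul_sum _ _ (QuadGauss.f x θ N), ← Finset.sum_sub_distrib]
    congr 1
    refine Finset.sum_congr rfl fun r _ => ?_
    rw [QuadGauss.C]
    ring
  -- The expansion errors at `θ` and `ε` add up, since `|f x θ N| = 1`.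
  refine ⟨(Tθ + Q θ) - QuadGauss.f x θ N * (Tε + Q ε), ?_, ?_⟩
  · rw [hlhs, hC]
    ring
  · refine (norm_sub_le _ _).trans ?_
    rw [norm_mul, QuadGauss.norm_f, one_mul, add_comm, mul_add]
    exact add_le_add hTε' hTθ'
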